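/- Let $M$ be a closed (compact, without boundary) smooth manifold and let $g_1,g_2$ be two smooth Riemannian metrics on $M$. For a Riemannian metric $g$ on $M$, consider the Borel probability measures $\mu$ on $TM$ that have finite first moment, $\int_{TM}\sqrt{g_x(v,v)}\,d\mu<\infty$, and are closed, i.e. $\int_{TM} df_x(v)\,d\mu=0$ for every $f\in C^1(M)$. The rotation vector $\rho(\mu)\in H_1(M;\mathbb R)$ of such a measure is the class determined by $\langle[\omega],\rho(\mu)\rangle=\int_{TM}\omega_x(v)\,d\mu(x,v)$ for every smooth closed 1-form $\omega$ on $M$, where $\langle[\omega],h\rangle$ is the integral of $\omega$ over any cycle representing $h$. Mather's $\beta$-function of $g$ is $$\beta_g(h)=\min_{\rho(\mu)=h}\ \int_{TM}\tfrac12\,g_x(v,v)\,d\mu(x,v),\qquad h\in H_1(M;\mathbb R).$$ Let $\mathfrak M_g^h$ be the set of the measures $\mu$ with $\rho(\mu)=h$ that achieve this minimum (the Mather measures of rotation vector $h$), let $\widetilde{\mathcal M}_g^h=\bigcup_{\mu\in\mathfrak M_g^h}\operatorname{supp}\mu\subset TM$ be the Mather set of homology class $h$, and let $\mathcal M_g^h\subset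 M$ be its image under the projection $TM\to M$. Finally let $$\mathcal C_{g_1}(g_2)=\max\{\,g_{2,x}(v,v):\ x\in M,\ v\in T_xM,\ g_{1,x}(v,v)=1\,\}.$$ Then: (i) $\beta_{g_2}(h)\le \mathcal C_{g_1}(g_2)\,\beta_{g_1}(h)$ for all $h\in H_1(M;\mathbb R)$. (ii) For every $h\in H_1(M;\mathbb R)\setminus\{0\}$, the equality $\beta_{g_2}(h)=\mathcal C_{g_1}(g_2)\,\beta_{g_1}(h)$ holds if and only if $\mathfrak M_{g_1}^h\subseteq\mathfrak M_{g_2}^h$, $g_{2,x}(v,v)=\mathcal C_{g_1}(g_2)\,g_{1,x}(v,v)$ for all $(x,v)\in\widetilde{\mathcal M}_{g_1}^h$, and $\widetilde{\mathcal M}_{g_1}^h\subseteq\widetilde{\mathcal M}_{g_2}^h$. (iii) Suppose that $g_2=\varphi\, g_1$ for some positive $\varphi\in C^\infty(M)$, and let $m=\max_M\varphi$. Then $\beta_{g_2}(h)\le m\,\beta_{g_1}(h)$ for all $h\in H_1(M;\mathbb R)$. Moreover, for every $h\in H_1(M;\mathbb R)\setminus\{0\}$, the equality $\beta_{g_2}(h)=m\,\beta_{g_1}(h)$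 holds if and only if $\mathfrak M_{g_1}^h\subseteq\mathfrak M_{g_2}^h$, $\varphi\equiv m$ on $\mathcal M_{g_1}^h$, and $\mathcal M_{g_1}^h\subseteq\mathcal M_{g_2}^h$. -/

import Mathlib

open scoped Manifold ContDiff Topology ENNReal Simplicial
open Set Filter MeasureTheory CategoryTheory

universe u

namespace MatherBeta

section

variable {n : ℕ} {M : Type u} [TopologicalSpace M]
  [ChartedSpace (EuclideanSpace ℝ (Fin n)) M]

/-- The tangent bundle `TM` carries its Borel `σ`-algebra. -/
noncomputable instance instMeasurableSpaceTangentBundle [IsManifold (𝓡 n) ∞ M] :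
    MeasurableSpace (TangentBundle (𝓡 n) M) := borel _

instance instBorelSpaceTangentBundle [IsManifold (𝓡 n) ∞ M] :
    BorelSpace (TangentBundle (𝓡 n) M) := ⟨rfl⟩

variable (n M) in
/-- Smooth Riemannian metrics on the `n`-dimensional manifold `M`. -/
abbrev Metric [IsManifold (𝓡 n) ∞ M] :=
  Bundle.ContMDiffRiemannianMetric (𝓡 n) ∞ (EuclideanSpace ℝ (Fin n))
    (fun x : M => TangentSpace (𝓡 n) x)

/-- The expression of a 1-form `η` in the chart of `M` around `x₀`: the pullback of `η` under the
inverse of the chart, a 1-form on the target of the chart, an open subset of `ℝⁿ`. -/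
noncomputable def coordForm (η : ∀ x : M, TangentSpace (𝓡 n) x →L[ℝ] ℝ) (x₀ : M)
    (y : EuclideanSpace ℝ (Fin n)) : EuclideanSpace ℝ (Fin n) →L[ℝ] ℝ :=
  (η ((extChartAt (𝓡 n) x₀).symm y)).comp
    (mfderiv 𝓘(ℝ, EuclideanSpace ℝ (Fin n)) (𝓡 n) (extChartAt (𝓡 n) x₀).symm y)

/-- The differential `df_x(v)` of a function `f` on `M` at a tangent vector `(x, v)`. -/
noncomputable def differential (f : M → ℝ) (p : TangentBundle (𝓡 n) M) : ℝ :=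
  mfderiv (𝓡 n) 𝓘(ℝ, ℝ) f p.1 p.2

variable (n M) in
/-- Smooth closed 1-forms on `M`: smooth sections of the cotangent bundle with `dη = 0`, that is
`∂ᵤ η(v) = ∂ᵥ η(u)` for all constant vectors `u, v` in all local coordinates. -/
structure ClosedOneForm [IsManifold (𝓡 n) ∞ M] where
  /-- The value of the form at a point. -/
  toFun (x : M) : TangentSpace (𝓡 n) x →L[ℝ] ℝ
  contMDiff : ContMDiff (𝓡 n) ((𝓡 n).prod 𝓘(ℝ, EuclideanSpace ℝ (Fin n) →L[ℝ] ℝ)) ∞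
    (fun x => Bundle.TotalSpace.mk' (EuclideanSpace ℝ (Fin n) →L[ℝ] ℝ) x (toFun x))
  closed (x₀ : M) : ∀ y ∈ (extChartAt (𝓡 n) x₀).target, ∀ u v : EuclideanSpace ℝ (Fin n),
    fderiv ℝ (coordForm toFun x₀) y u v = fderiv ℝ (coordForm toFun x₀) y v u

/-- `F` is a primitive of the closed 1-form `η` along the continuous path `γ`: near every
parameter `t`, it is, up to a constant, the composition with `γ` of a primitive of `η` that is
defined on a neighbourhood of `γ t`. -/
def IsPrimitiveAlong [IsManifold (𝓡 n) ∞ M] (η : ClosedOneForm n M) (γ : C(unitInterval, M))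
    (F : unitInterval → ℝ) : Prop :=
  ∀ t, ∃ (U : Set M) (f : M → ℝ), IsOpen U ∧ γ t ∈ U ∧ ContMDiffOn (𝓡 n) 𝓘(ℝ, ℝ) ∞ f U ∧
    (∀ x ∈ U, ∀ v : TangentSpace (𝓡 n) x, differential f ⟨x, v⟩ = η.toFun x v) ∧
    ∀ᶠ s in 𝓝 t, F s - F t = f (γ s) - f (γ t)

open Classical in
/-- The integral `∫_γ η` of a closed 1-form along a continuous path, by continuation of local
primitives. A primitive along `γ` always exists and is unique up to an additive constant, because
closed 1-forms are locally exact; the default value is never used. For a piecewise `C¹` path this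
is `∫₀¹ η(γ'(t)) dt`. -/
noncomputable def pathIntegral [IsManifold (𝓡 n) ∞ M] (η : ClosedOneForm n M)
    (γ : C(unitInterval, M)) : ℝ :=
  if hF : ∃ F : unitInterval → ℝ, IsPrimitiveAlong η γ F then
    hF.choose 1 - hF.choose 0
  else 0

/-- The coefficients `ℝ` of the homology, in the universe of the manifold. -/
abbrev coeff : ModuleCat.{u} ℝ := ModuleCat.of ℝ (ULift.{u} ℝ)

variable (M) in
/-- The singular simplicial set of `M`. -/
noncomputable abbrev singularSet : SSet.{u} := TopCat.toSSet.obj (TopCat.of M)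

variable (M) in
/-- The complex of singular chains of `M` with real coefficients. -/
noncomputable abbrev singularChains : ChainComplex (ModuleCat.{u} ℝ) ℕ :=
  ((AlgebraicTopology.singularChainComplexFunctor (ModuleCat.{u} ℝ)).obj coeff.{u}).obj
    (TopCat.of M)

variable (M) in
/-- The first real singular homology group `H₁(M; ℝ)`. -/
noncomputable abbrev H1 : ModuleCat.{u} ℝ := (singularChains M).homology 1

/-- A singular 1-simplex as a path from its vertex `0` to its vertex `1`. -/
noncomputable def simplexPath (σ : (singularSet M) _⦋1⦌) : C(unitInterval, M) :=
  ((TopCat.of M).toSSetObjEquiv _ σ).comp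
    ⟨stdSimplexHomeomorphUnitInterval.symm, stdSimplexHomeomorphUnitInterval.symm.continuous⟩

/-- Integration of the closed 1-form `η` over singular 1-chains, the linear map with value
`∫_σ η` at each singular 1-simplex `σ`. -/
noncomputable def chainIntegral [IsManifold (𝓡 n) ∞ M] (η : ClosedOneForm n M) :
    (singularChains M).X 1 ⟶ coeff.{u} :=
  Limits.Cofan.IsColimit.desc ((singularSet M).isColimitChainComplexXCofan coeff.{u} 1)
    (fun σ => pathIntegral η (simplexPath σ) • 𝟙 coeff.{u})

/-- `μ` is a closed Borel probability measure on `TM` with finite first moment. -/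
structure IsClosedMeasure [IsManifold (𝓡 n) ∞ M] (g : Metric n M)
    (μ : Measure (TangentBundle (𝓡 n) M)) : Prop where
  isProbabilityMeasure : IsProbabilityMeasure μ
  finite_moment : ∫⁻ p, ENNReal.ofReal (Real.sqrt (g.inner p.1 p.2 p.2)) ∂μ < ⊤
  closed : ∀ f : M → ℝ, ContMDiff (𝓡 n) 𝓘(ℝ, ℝ) 1 f →
    ∫ p, differential f p ∂μ = 0

/-- `ρ(μ) = h`: the rotation vector of `μ` is the homology class `h`, that is,
`∫ η_x(v) dμ(x, v) = ⟨[η], h⟩` for every closed 1-form `η`, where `⟨[η], h⟩` is the integral of `η`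
over a singular cycle `z` of class `h`. -/
def HasRotationVector [IsManifold (𝓡 n) ∞ M] (μ : Measure (TangentBundle (𝓡 n) M))
    (h : H1 M) : Prop :=
  ∀ z : (singularChains M).cycles 1, (singularChains M).homologyπ 1 z = h →
    ∀ η : ClosedOneForm n M,
      ∫ p, η.toFun p.1 p.2 ∂μ =
        (chainIntegral η ((singularChains M).iCycles 1 z) : ULift.{u} ℝ).down

/-- The set `ρ⁻¹(h)` of closed probability measures with finite first moment and rotation
vector `h`. -/
def rotationFiber [IsManifold (𝓡 n) ∞ M] (g : Metric n M) (h : H1 M) :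
    Set (Measure (TangentBundle (𝓡 n) M)) :=
  {μ | IsClosedMeasure g μ ∧ HasRotationVector μ h}

/-- The Lagrangian `L_g(x, v) = ½ g_x(v, v)`. -/
noncomputable def lagrangian [IsManifold (𝓡 n) ∞ M] (g : Metric n M)
    (p : TangentBundle (𝓡 n) M) : ℝ :=
  1 / 2 * g.inner p.1 p.2 p.2

/-- The action `∫ L_g dμ`, a number in `[0, ∞]`. -/
noncomputable def action [IsManifold (𝓡 n) ∞ M] (g : Metric n M)
    (μ : Measure (TangentBundle (𝓡 n) M)) : ℝ≥0∞ :=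
  ∫⁻ p, ENNReal.ofReal (lagrangian g p) ∂μ

/-- Mather's `β`-function `β_g(h) = min {∫ L_g dμ : ρ(μ) = h}`. -/
noncomputable def beta [IsManifold (𝓡 n) ∞ M] (g : Metric n M) (h : H1 M) : ℝ :=
  (⨅ μ ∈ rotationFiber g h, action g μ).toReal

/-- The set `𝔐_g^h` of Mather measures of rotation vector `h`: those that achieve the minimum. -/
def matherMeasures [IsManifold (𝓡 n) ∞ M] (g : Metric n M) (h : H1 M) :
    Set (Measure (TangentBundle (𝓡 n) M)) :=
  {μ | μ ∈ rotationFiber g h ∧ action g μ = ENNReal.ofReal (beta g h)}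

/-- The Mather set of homology class `h`, the union in `TM` of the supports of the Mather measures
of rotation vector `h`. -/
def matherSet [IsManifold (𝓡 n) ∞ M] (g : Metric n M) (h : H1 M) :
    Set (TangentBundle (𝓡 n) M) :=
  ⋃ μ ∈ matherMeasures g h, μ.support

/-- The projected Mather set of homology class `h`, the image of the Mather set in `M`. -/
def projectedMatherSet [IsManifold (𝓡 n) ∞ M] (g : Metric n M) (h : H1 M) : Set M :=
  (fun p : TangentBundle (𝓡 n) M => p.1) '' matherSet g h

/-- The factor `C_{g₁}(g₂)`, the maximum of `g₂(v, v)` over all tangent vectors `v` with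
`g₁(v, v) = 1`. -/
noncomputable def distortion [IsManifold (𝓡 n) ∞ M] (g₁ g₂ : Metric n M) : ℝ :=
  sSup {c | ∃ (x : M) (v : TangentSpace (𝓡 n) x), g₁.inner x v v = 1 ∧ c = g₂.inner x v v}

end

end MatherBeta

/-! ### Continuity, scaling and compactness on the tangent bundle. -/

namespace MatherBeta

variable {n : ℕ} {M : Type u} [TopologicalSpace M]
  [ChartedSpace (EuclideanSpace ℝ (Fin n)) M] [IsManifold (𝓡 n) ∞ M]

lemma continuous_tangentBundle_proj :
    Continuous (fun p : TangentBundle (𝓡 n) M => p.1) :=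
  FiberBundle.continuous_proj (EuclideanSpace ℝ (Fin n)) _

lemma Metric.continuous_inner (g : Metric n M) :
    Continuous (fun p : TangentBundle (𝓡 n) M => g.inner p.1 p.2 p.2) := by
  have hid : Continuous (fun p : TangentBundle (𝓡 n) M =>
    (⟨p.1, p.2⟩ : TangentBundle (𝓡 n) M)) := continuous_id
  have := (g.contMDiff.continuous.comp continuous_tangentBundle_proj).clm_bundle_apply₂
    (F₁ := EuclideanSpace ℝ (Fin n)) (F₂ := EuclideanSpace ℝ (Fin n)) (F₃ := ℝ)
    (E₃ := Bundle.Trivial M ℝ) hid hid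
  rw [continuous_iff_continuousAt] at this ⊢
  exact fun p => ((FiberBundle.continuousAt_totalSpace _ _).1 (this p)).2

lemma ClosedOneForm.continuous (η : ClosedOneForm n M) :
    Continuous (fun p : TangentBundle (𝓡 n) M => η.toFun p.1 p.2) := by
  have hid : Continuous (fun p : TangentBundle (𝓡 n) M =>
    (⟨p.1, p.2⟩ : TangentBundle (𝓡 n) M)) := continuous_id
  have := (η.contMDiff.continuous.comp continuous_tangentBundle_proj).clm_bundle_apply
    (F₁ := EuclideanSpace ℝ (Fin n)) (F₂ := ℝ) (E₂ := Bundle.Trivial M ℝ) hid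
  rw [continuous_iff_continuousAt] at this ⊢
  exact fun p => ((FiberBundle.continuousAt_totalSpace _ _).1 (this p)).2

lemma continuous_differential {f : M → ℝ} (hf : ContMDiff (𝓡 n) 𝓘(ℝ, ℝ) 1 f) :
    Continuous (differential f : TangentBundle (𝓡 n) M → ℝ) := by
  have : IsManifold (𝓡 n) 1 M := IsManifold.of_le (n := ∞) (by simp)
  have := hf.continuous_tangentMap le_rfl
  rw [continuous_iff_continuousAt] at this ⊢
  intro p
  have h := ((FiberBundle.continuousAt_totalSpace _ _).1 (this p)).2
  simpa [tangentMap] using! h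

lemma Metric.inner_nonneg (g : Metric n M) (x : M) (v : TangentSpace (𝓡 n) x) :
    0 ≤ g.inner x v v := by
  rcases eq_or_ne v 0 with rfl | h
  · simp
  · exact (g.pos x v h).le

lemma Metric.inner_eq_zero_iff (g : Metric n M) {x : M} {v : TangentSpace (𝓡 n) x} :
    g.inner x v v = 0 ↔ v = 0 := by
  refine ⟨fun h => ?_, fun h => by simp [h]⟩
  by_contra hv
  exact (g.pos x v hv).ne' h

lemma Metric.inner_smul_smul (g : Metric n M) (x : M) (c : ℝ) (v : TangentSpace (𝓡 n) x) :
    g.inner x (c • v) (c • v) = c ^ 2 * g.inner x v v := by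
  simp [pow_two, mul_assoc]

/-- Fibrewise scaling of tangent vectors. -/
noncomputable def scale (c : ℝ) (p : TangentBundle (𝓡 n) M) : TangentBundle (𝓡 n) M :=
  ⟨p.1, c • p.2⟩

lemma continuous_scale (c : ℝ) :
    Continuous (scale c : TangentBundle (𝓡 n) M → TangentBundle (𝓡 n) M) := by
  rw [continuous_iff_continuousAt]
  intro p
  rw [FiberBundle.continuousAt_totalSpace (EuclideanSpace ℝ (Fin n))]
  refine ⟨continuous_tangentBundle_proj.continuousAt, ?_⟩
  have h := ((FiberBundle.continuousAt_totalSpace (EuclideanSpace ℝ (Fin n))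
    (id : TangentBundle (𝓡 n) M → _)).1 (continuousAt_id (x := p))).2
  refine (h.const_smul c).congr ?_
  have hb : ∀ᶠ q : TangentBundle (𝓡 n) M in 𝓝 p, q.1 ∈
      (trivializationAt (EuclideanSpace ℝ (Fin n)) (TangentSpace (𝓡 n)) p.1).baseSet :=
    continuous_tangentBundle_proj.continuousAt.eventually
      ((trivializationAt (EuclideanSpace ℝ (Fin n)) (TangentSpace (𝓡 n)) p.1).open_baseSet.mem_nhds
        (FiberBundle.mem_baseSet_trivializationAt' p.1))
  filter_upwards [hb] with q hq
  exact (((trivializationAt (EuclideanSpace ℝ (Fin n)) (TangentSpace (𝓡 n)) p.1).linear ℝ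
    hq).map_smul c q.2).symm

instance [T2Space M] : T2Space (TangentBundle (𝓡 n) M) := by
  refine ⟨fun p q hpq => ?_⟩
  by_cases h : p.1 = q.1
  · let e := trivializationAt (EuclideanSpace ℝ (Fin n)) (TangentSpace (𝓡 n)) p.1
    have hp : p ∈ e.source := by
      rw [e.mem_source]; exact FiberBundle.mem_baseSet_trivializationAt' p.1
    have hq : q ∈ e.source := by
      rw [e.mem_source, ← h]; exact FiberBundle.mem_baseSet_trivializationAt' p.1
    have hne : e p ≠ e q := fun h' => hpq (e.injOn hp hq h')
    obtain ⟨U, V, hU, hV, hpU, hqV, hUV⟩ := t2_separation hne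
    refine ⟨e.source ∩ e ⁻¹' U, e.source ∩ e ⁻¹' V,
      e.continuousOn.isOpen_inter_preimage e.open_source hU,
      e.continuousOn.isOpen_inter_preimage e.open_source hV, ⟨hp, hpU⟩, ⟨hq, hqV⟩, ?_⟩
    rw [Set.disjoint_left] at hUV ⊢
    exact fun x hx hx' => hUV hx.2 hx'.2
  · exact separated_by_continuous continuous_tangentBundle_proj h

open scoped Bundle in
lemma exists_norm_trivializationAt_le {B F : Type*} {E : B → Type*} [TopologicalSpace B]
    [NormedAddCommGroup F] [NormedSpace ℝ F] [TopologicalSpace (Bundle.TotalSpace F E)]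
    [∀ x, TopologicalSpace (E x)] [∀ x, AddCommGroup (E x)] [∀ x, Module ℝ (E x)]
    [∀ x, IsTopologicalAddGroup (E x)] [∀ x, ContinuousConstSMul ℝ (E x)] [FiberBundle F E]
    [VectorBundle ℝ F E] (g : Bundle.ContinuousRiemannianMetric F E) (x : B) :
    ∃ C > 0, ∀ᶠ y in 𝓝 x, ∀ v : E y,
      ‖(trivializationAt F E x ⟨y, v⟩).2‖ ≤ C * √(g.inner y v v) := by
  let : Bundle.RiemannianBundle E := ⟨g.toRiemannianMetric⟩
  have : IsContinuousRiemannianBundle F E := ⟨g.inner, g.continuous, fun _ _ _ => rfl⟩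
  obtain ⟨C, hC, hev⟩ := eventually_norm_trivializationAt_lt F E x
  refine ⟨C, hC, ?_⟩
  filter_upwards [hev, (trivializationAt F E x).open_baseSet.mem_nhds
    (FiberBundle.mem_baseSet_trivializationAt' x)] with y hy hyb v
  have h1 := ((trivializationAt F E x).continuousLinearMapAt ℝ y).le_opNorm v
  rw [Bundle.Trivialization.continuousLinearMapAt_apply,
    Bundle.Trivialization.linearMapAt_apply, if_pos hyb] at h1
  exact h1.trans (mul_le_mul_of_nonneg_right hy.le (norm_nonneg _))

/-- Over a small compact `K` in the base, vectors of bounded length lie in the image of `K` times a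
closed ball under a trivialization; finitely many such `K` cover `M`. -/
lemma Metric.isCompact_sublevel [CompactSpace M] (g : Metric n M) (R : ℝ) :
    IsCompact (X := TangentBundle (𝓡 n) M) {p | g.inner p.1 p.2 p.2 ≤ R} := by
  have hloc : ∀ x : M, ∃ U ∈ 𝓝 x, ∃ T : Set (TangentBundle (𝓡 n) M), IsCompact T ∧
      ∀ p : TangentBundle (𝓡 n) M, p.1 ∈ U → g.inner p.1 p.2 p.2 ≤ R → p ∈ T := by
    intro x
    obtain ⟨C, hC, hev⟩ := exists_norm_trivializationAt_le (F := EuclideanSpace ℝ (Fin n))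
      (E := fun x : M => TangentSpace (𝓡 n) x) g.toContinuousRiemannianMetric x
    let e := trivializationAt (EuclideanSpace ℝ (Fin n)) (TangentSpace (𝓡 n)) x
    have : LocallyCompactSpace M := ChartedSpace.locallyCompactSpace (EuclideanSpace ℝ (Fin n)) M
    obtain ⟨K, hK, hKsub, hKc⟩ := local_compact_nhds (Filter.inter_mem hev
      (e.open_baseSet.mem_nhds (FiberBundle.mem_baseSet_trivializationAt' x)))
    refine ⟨K, hK, e.toOpenPartialHomeomorph.symm '' (K ×ˢ Metric.closedBall 0 (C * √R)), ?_, ?_⟩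
    · refine (hKc.prod (isCompact_closedBall _ _)).image_of_continuousOn
        (e.toOpenPartialHomeomorph.continuousOn_symm.mono ?_)
      refine subset_trans ?_ e.target_eq.ge
      exact Set.prod_mono (fun y hy => (hKsub hy).2) (subset_univ _)
    · intro p hp hpR
      have hpe : p ∈ e.source := e.mem_source.2 (hKsub hp).2
      refine ⟨e p, ⟨?_, ?_⟩, e.toOpenPartialHomeomorph.left_inv hpe⟩
      · rw [e.coe_fst hpe]; exact hp
      · rw [mem_closedBall_zero_iff]
        refine ((hKsub hp).1 p.2).trans ?_
        gcongr
        exact hpR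
  choose U hU T hT hUT using hloc
  obtain ⟨t, ht⟩ := isCompact_univ.elim_nhds_subcover U fun x _ => hU x
  refine (t.isCompact_biUnion fun x _ => hT x).of_isClosed_subset
    (isClosed_le g.continuous_inner continuous_const) fun p hp => ?_
  obtain ⟨x, hx, hpx⟩ := mem_iUnion₂.1 (ht.2 (mem_univ p.1))
  exact mem_iUnion₂.2 ⟨x, hx, hUT x p hpx hp⟩

/-- Guarantees that the support of a measure on `TM` has full measure. -/
lemma secondCountableTopology_tangentBundle [CompactSpace M] (g : Metric n M) :
    SecondCountableTopology (TangentBundle (𝓡 n) M) := by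
  have : SigmaCompactSpace (TangentBundle (𝓡 n) M) := by
    refine ⟨⟨fun k : ℕ => {p | g.inner p.1 p.2 p.2 ≤ k}, fun k => g.isCompact_sublevel k, ?_⟩⟩
    refine eq_univ_of_forall fun p => mem_iUnion.2 ?_
    exact exists_nat_ge (g.inner p.1 p.2 p.2)
  have : SecondCountableTopology
      (ModelProd (EuclideanSpace ℝ (Fin n)) (EuclideanSpace ℝ (Fin n))) :=
    inferInstanceAs (SecondCountableTopology (_ × _))
  exact ChartedSpace.secondCountable_of_sigmaCompact
    (ModelProd (EuclideanSpace ℝ (Fin n)) (EuclideanSpace ℝ (Fin n))) _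

/-- A continuous function on the tangent bundle that is homogeneous of degree two on the fibres is
bounded by a multiple of the metric. -/
lemma Metric.exists_le_mul_inner [CompactSpace M] (g : Metric n M)
    {ψ : TangentBundle (𝓡 n) M → ℝ} (hψ : Continuous ψ)
    (hhom : ∀ c p, ψ (scale c p) = c ^ 2 * ψ p) :
    ∃ C : ℝ, 0 ≤ C ∧ ∀ p, ψ p ≤ C * g.inner p.1 p.2 p.2 := by
  obtain ⟨C, hC⟩ := (g.isCompact_sublevel 1).bddAbove_image hψ.continuousOn
  refine ⟨max C 0, le_max_right _ _, fun p => ?_⟩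
  rcases eq_or_ne p.2 0 with hp | hp
  -- A zero vector is its own scaling by `0`, so homogeneity forces `ψ p = 0`.
  · have h0 := hhom 0 p
    have : scale 0 p = p := by
      rcases p with ⟨x, v⟩
      simp only at hp
      simp [scale, hp]
    rw [this] at h0
    rw [zero_pow two_ne_zero, zero_mul] at h0
    rw [h0, g.inner_eq_zero_iff.2 hp, mul_zero]
  · have hpos := g.pos p.1 p.2 hp
    set q := g.inner p.1 p.2 p.2 with hq
    have h1 : ψ (scale (√q)⁻¹ p) ≤ C := by
      refine hC ⟨_, ?_, rfl⟩
      simp only [scale, mem_ofPred_eq, g.inner_smul_smul, ← hq]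
      rw [inv_pow, Real.sq_sqrt hpos.le, inv_mul_cancel₀ hpos.ne']
    rw [hhom, inv_pow, Real.sq_sqrt hpos.le, inv_mul_le_iff₀ hpos, mul_comm] at h1
    exact h1.trans (mul_le_mul_of_nonneg_right (le_max_left _ _) hpos.le)

/-- Without boundedness the real `sSup` defining `distortion` would be the default `0`. -/
lemma bddAbove_distortion [CompactSpace M] (g₁ g₂ : Metric n M) :
    BddAbove {c | ∃ (x : M) (v : TangentSpace (𝓡 n) x),
      g₁.inner x v v = 1 ∧ c = g₂.inner x v v} := by
  obtain ⟨C, -, hC⟩ := g₁.exists_le_mul_inner g₂.continuous_inner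
    fun c p => g₂.inner_smul_smul p.1 c p.2
  refine ⟨C, ?_⟩
  rintro _ ⟨x, v, hv, rfl⟩
  simpa [hv] using hC ⟨x, v⟩

lemma inner_le_distortion_mul [CompactSpace M] (g₁ g₂ : Metric n M) (x : M)
    (v : TangentSpace (𝓡 n) x) :
    g₂.inner x v v ≤ distortion g₁ g₂ * g₁.inner x v v := by
  rcases eq_or_ne v 0 with rfl | hv
  · simp
  · have hpos := g₁.pos x v hv
    set q := g₁.inner x v v with hq
    have h1 : g₂.inner x ((√q)⁻¹ • v) ((√q)⁻¹ • v) ≤ distortion g₁ g₂ := by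
      refine le_csSup (bddAbove_distortion g₁ g₂) ⟨x, (√q)⁻¹ • v, ?_, rfl⟩
      rw [g₁.inner_smul_smul, ← hq, inv_pow, Real.sq_sqrt hpos.le, inv_mul_cancel₀ hpos.ne']
    rwa [g₂.inner_smul_smul, inv_pow, Real.sq_sqrt hpos.le, inv_mul_le_iff₀ hpos, mul_comm] at h1

lemma distortion_nonneg (g₁ g₂ : Metric n M) : 0 ≤ distortion g₁ g₂ := by
  refine Real.sSup_nonneg ?_
  rintro _ ⟨x, v, -, rfl⟩
  exact g₂.inner_nonneg x v

end MatherBeta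

/-! ### Weak limits and unbounded integrands. -/

namespace MatherBeta

section WeakLimits

variable {X ι : Type*} [TopologicalSpace X] [MeasurableSpace X] [BorelSpace X]
  {l : Filter ι} {μs : ι → ProbabilityMeasure X} {μ : ProbabilityMeasure X} {L : X → ℝ}

/-- Each truncation `min L N` is bounded and continuous, so its integrals converge; monotone
convergence in `N` recovers `L`. -/
lemma lintegral_ofReal_le_of_tendsto [l.NeBot] (hμ : Tendsto μs l (𝓝 μ)) (hL : Continuous L)
    {a : ℝ≥0∞} (ha : ∀ᶠ i in l, ∫⁻ x, ENNReal.ofReal (L x) ∂(μs i : Measure X) ≤ a) :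
    ∫⁻ x, ENNReal.ofReal (L x) ∂(μ : Measure X) ≤ a := by
  rw [ProbabilityMeasure.tendsto_iff_forall_lintegral_tendsto] at hμ
  have hsup : ∀ x, ENNReal.ofReal (L x) = ⨆ N : ℕ, min (ENNReal.ofReal (L x)) N := by
    intro x
    refine le_antisymm ?_ (iSup_le fun N => min_le_left _ _)
    obtain ⟨N, hN⟩ := exists_nat_ge (L x)
    refine le_iSup_of_le N (le_min le_rfl ?_)
    exact ENNReal.ofReal_le_of_le_toReal (by rwa [ENNReal.toReal_natCast])
  rw [lintegral_congr hsup]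
  rw [lintegral_iSup]
  · refine iSup_le fun N => ?_
    let f : BoundedContinuousFunction X NNReal :=
      BoundedContinuousFunction.mkOfBound ⟨fun x => min (L x).toNNReal N, by fun_prop⟩ N (by
        intro x y
        rw [NNReal.dist_eq, abs_sub_le_iff]
        have h1 : ((min (L x).toNNReal N : NNReal) : ℝ) ≤ N := by
          exact_mod_cast min_le_right (L x).toNNReal (N : NNReal)
        have h2 : ((min (L y).toNNReal N : NNReal) : ℝ) ≤ N := by
          exact_mod_cast min_le_right (L y).toNNReal (N : NNReal)
        have h3 := (min (L x).toNNReal N : NNReal).2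
        have h4 := (min (L y).toNNReal N : NNReal).2
        simp only [ContinuousMap.coe_mk, NNReal.val_eq_coe] at *
        constructor <;> linarith)
    have hf : ∀ x, (f x : ℝ≥0∞) = min (ENNReal.ofReal (L x)) N := by
      intro x
      simp [f, ENNReal.ofReal]
    have := hμ f
    simp_rw [hf] at this
    refine le_of_tendsto this (ha.mono fun i hi => le_trans (lintegral_mono fun x => ?_) hi)
    exact min_le_left _ _
  · intro N
    exact (hL.measurable.ennreal_ofReal).min measurable_const
  · intro N N' h x
    exact min_le_min le_rfl (by exact_mod_cast h)

lemma integrable_of_sq_le {μ : Measure X} [IsProbabilityMeasure μ] (hL : Continuous L)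
    (hfin : ∫⁻ x, ENNReal.ofReal (L x) ∂μ ≠ ⊤) {ψ : X → ℝ} (hψ : Continuous ψ)
    (hψL : ∀ x, ψ x ^ 2 ≤ L x) : Integrable ψ μ := by
  have hLi : Integrable L μ := by
    refine ⟨hL.measurable.aestronglyMeasurable, ?_⟩
    rw [hasFiniteIntegral_iff_ofReal (.of_forall fun x => (sq_nonneg _).trans (hψL x))]
    exact hfin.lt_top
  refine Integrable.mono' (hLi.add (integrable_const 1)) hψ.measurable.aestronglyMeasurable
    (.of_forall fun x => ?_)
  have := hψL x
  rw [Real.norm_eq_abs, ← sq_abs] at *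
  simp only [Pi.add_apply]
  nlinarith [sq_nonneg (|ψ x| - 1), abs_nonneg (ψ x)]

/-- Truncation of a function to the interval `[-R, R]` changes the integral by at most `B / R`
when the square of the function has integral at most `B`. -/
lemma abs_integral_sub_integral_truncation_le {μ : Measure X} [IsProbabilityMeasure μ]
    (hL : Continuous L) {B : ℝ} (hB : 0 ≤ B)
    (hfin : ∫⁻ x, ENNReal.ofReal (L x) ∂μ ≤ ENNReal.ofReal B) {ψ : X → ℝ} (hψ : Continuous ψ)
    (hψL : ∀ x, ψ x ^ 2 ≤ L x) {R : ℝ} (hR : 0 < R) :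
    |∫ x, ψ x ∂μ - ∫ x, max (-R) (min (ψ x) R) ∂μ| ≤ B / R := by
  have hne := ne_top_of_le_ne_top ENNReal.ofReal_ne_top hfin
  have hψi := integrable_of_sq_le hL hne hψ hψL
  have hLnn : ∀ x, 0 ≤ L x := fun x => (sq_nonneg _).trans (hψL x)
  have hLi : Integrable L μ := by
    refine ⟨hL.measurable.aestronglyMeasurable, ?_⟩
    rw [hasFiniteIntegral_iff_ofReal (.of_forall hLnn)]
    exact hne.lt_top
  have htr : Integrable (fun x => max (-R) (min (ψ x) R)) μ := by
    refine Integrable.mono' (integrable_const R)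
      (by fun_prop : Continuous _).measurable.aestronglyMeasurable (.of_forall fun x => ?_)
    rw [Real.norm_eq_abs, abs_le]
    exact ⟨le_max_left _ _, max_le (by linarith) (min_le_right _ _)⟩
  rw [← integral_sub hψi htr, ← Real.norm_eq_abs]
  -- The error vanishes where `|ψ| ≤ R`; elsewhere it is `|ψ| - R`, and `(|ψ| - R) R ≤ ψ² ≤ L`.
  have hbound : ∀ x, ‖ψ x - max (-R) (min (ψ x) R)‖ ≤ L x / R := by
    intro x
    rw [le_div_iff₀ hR]
    refine le_trans ?_ (hψL x)
    rw [Real.norm_eq_abs]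
    rcases le_total (ψ x) R with h | h
    · rw [min_eq_left h]
      rcases le_total (-R) (ψ x) with h' | h'
      · rw [max_eq_right h']; simp [sq_nonneg]
      · rw [max_eq_left h', abs_of_nonpos (by linarith)]; nlinarith
    · rw [min_eq_right h, max_eq_right (by linarith), abs_of_nonneg (by linarith)]; nlinarith
  refine (norm_integral_le_of_norm_le (hLi.div_const R) (.of_forall hbound)).trans ?_
  rw [integral_div]
  gcongr
  rw [integral_eq_lintegral_of_nonneg_ae (.of_forall hLnn) hL.measurable.aestronglyMeasurable]
  exact ENNReal.toReal_le_of_le_ofReal hB hfin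

/-- Weak convergence only tests bounded functions, but the bound on `ψ²` makes the truncation error
uniform in `i`. This covers 1-forms, which are unbounded on `TM`. -/
lemma tendsto_integral_of_sq_le (hμ : Tendsto μs l (𝓝 μ)) (hL : Continuous L) {B : ℝ}
    (hB : ∀ i, ∫⁻ x, ENNReal.ofReal (L x) ∂(μs i : Measure X) ≤ ENNReal.ofReal B)
    {ψ : X → ℝ} (hψ : Continuous ψ) (hψL : ∀ x, ψ x ^ 2 ≤ L x) :
    Tendsto (fun i => ∫ x, ψ x ∂(μs i : Measure X)) l (𝓝 (∫ x, ψ x ∂(μ : Measure X))) := by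
  rcases l.eq_or_neBot with rfl | hl
  · simp
  have hBμ := lintegral_ofReal_le_of_tendsto hμ hL (.of_forall hB)
  wlog hB0 : 0 ≤ B generalizing B
  · refine this (B := 0) ?_ ?_ le_rfl
    · rwa [ENNReal.ofReal_of_nonpos (le_of_not_ge hB0), ← ENNReal.ofReal_zero] at hB
    · rwa [ENNReal.ofReal_of_nonpos (le_of_not_ge hB0), ← ENNReal.ofReal_zero] at hBμ
  rw [_root_.Metric.tendsto_nhds]
  intro ε hε
  obtain ⟨R, hR, hRε⟩ : ∃ R : ℝ, 0 < R ∧ B / R < ε / 3 := by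
    refine ⟨3 * (B + 1) / ε, by positivity, ?_⟩
    rw [div_lt_iff₀ (by positivity)]
    field_simp
    linarith
  let f : BoundedContinuousFunction X ℝ :=
    BoundedContinuousFunction.ofNormedAddCommGroup (fun x => max (-R) (min (ψ x) R))
      (by fun_prop) R (fun x => by
        rw [Real.norm_eq_abs, abs_le]
        exact ⟨le_max_left _ _, max_le (by linarith) (min_le_right _ _)⟩)
  have hf := ProbabilityMeasure.tendsto_iff_forall_integral_tendsto.1 hμ f
  rw [_root_.Metric.tendsto_nhds] at hf
  filter_upwards [hf (ε / 3) (by positivity)] with i hi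
  have h1 := abs_integral_sub_integral_truncation_le hL hB0 (hB i) hψ hψL hR
  have h2 := abs_integral_sub_integral_truncation_le hL hB0 hBμ hψ hψL hR
  simp only [f, BoundedContinuousFunction.coe_ofNormedAddCommGroup] at hi
  rw [Real.dist_eq] at hi ⊢
  rw [abs_le] at h1 h2
  rw [abs_lt] at hi ⊢
  constructor <;> linarith

end WeakLimits

end MatherBeta

/-! ### Comparison of actions and existence of Mather measures. -/

namespace MatherBeta

variable {n : ℕ} {M : Type u} [TopologicalSpace M]
  [ChartedSpace (EuclideanSpace ℝ (Fin n)) M] [IsManifold (𝓡 n) ∞ M]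

lemma Metric.measurable_inner (g : Metric n M) :
    Measurable (fun p : TangentBundle (𝓡 n) M => g.inner p.1 p.2 p.2) :=
  g.continuous_inner.measurable

lemma measurable_lagrangian (g : Metric n M) :
    Measurable (fun p => ENNReal.ofReal (lagrangian g p)) :=
  (g.measurable_inner.const_mul _).ennreal_ofReal

lemma lintegral_inner_eq_two_mul_action (g : Metric n M) (μ : Measure (TangentBundle (𝓡 n) M)) :
    ∫⁻ p, ENNReal.ofReal (g.inner p.1 p.2 p.2) ∂μ = 2 * action g μ := by
  rw [action, ← lintegral_const_mul _ (measurable_lagrangian g)]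
  refine lintegral_congr fun p => ?_
  have h2 : (2 : ℝ≥0∞) * ENNReal.ofReal (lagrangian g p) =
      ENNReal.ofReal (2 * lagrangian g p) := by
    rw [ENNReal.ofReal_mul (by norm_num), ENNReal.ofReal_ofNat]
  rw [h2, lagrangian]
  congr 1
  ring

lemma action_le_mul (g₁ g₂ : Metric n M) {C : ℝ} (hC : 0 ≤ C)
    (hle : ∀ (x : M) (v : TangentSpace (𝓡 n) x), g₂.inner x v v ≤ C * g₁.inner x v v)
    (μ : Measure (TangentBundle (𝓡 n) M)) :
    action g₂ μ ≤ ENNReal.ofReal C * action g₁ μ := by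
  rw [action, action, ← lintegral_const_mul _ (measurable_lagrangian g₁)]
  refine lintegral_mono fun p => ?_
  rw [← ENNReal.ofReal_mul hC]
  refine ENNReal.ofReal_le_ofReal ?_
  have := hle p.1 p.2
  simp only [lagrangian]
  linarith

/-- The metric enters the fibre only through the moment condition. Exchanging the metrics shows that
the fibres coincide. -/
lemma rotationFiber_subset [CompactSpace M] (g₁ g₂ : Metric n M) (h : H1 M) :
    rotationFiber g₁ h ⊆ rotationFiber g₂ h := by
  rintro μ ⟨⟨hprob, hmom, hcl⟩, hrot⟩
  refine ⟨⟨hprob, ?_, hcl⟩, hrot⟩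
  refine lt_of_le_of_lt (lintegral_mono fun p => ENNReal.ofReal_le_ofReal
    (Real.sqrt_le_sqrt (inner_le_distortion_mul g₁ g₂ p.1 p.2))) ?_
  simp_rw [Real.sqrt_mul (distortion_nonneg g₁ g₂), ENNReal.ofReal_mul (Real.sqrt_nonneg _)]
  rw [lintegral_const_mul _ (g₁.measurable_inner.sqrt.ennreal_ofReal)]
  exact ENNReal.mul_lt_top ENNReal.ofReal_lt_top hmom

/-- The infimum of the action over `ρ⁻¹(h)`, as an extended nonnegative real. -/
noncomputable def minimalAction (g : Metric n M) (h : H1 M) : ℝ≥0∞ :=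
  ⨅ μ ∈ rotationFiber g h, action g μ

lemma minimalAction_le (g : Metric n M) {h : H1 M} {μ : Measure (TangentBundle (𝓡 n) M)}
    (hμ : μ ∈ rotationFiber g h) : minimalAction g h ≤ action g μ :=
  iInf₂_le μ hμ

lemma minimalAction_le_mul [CompactSpace M] (g₁ g₂ : Metric n M) {C : ℝ} (hC : 0 ≤ C)
    (hle : ∀ (x : M) (v : TangentSpace (𝓡 n) x), g₂.inner x v v ≤ C * g₁.inner x v v) {h : H1 M}
    (hfin : minimalAction g₁ h ≠ ⊤) :
    minimalAction g₂ h ≤ ENNReal.ofReal C * minimalAction g₁ h := by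
  -- Over an empty fibre both infima are `⊤`, and the inequality would fail for `C = 0`.
  obtain ⟨ν, hν, -⟩ : ∃ ν ∈ rotationFiber g₁ h, action g₁ ν < ⊤ := by
    simpa [minimalAction, lt_top_iff_ne_top] using hfin
  have hne : Nonempty (rotationFiber g₁ h) := ⟨⟨ν, hν⟩⟩
  rw [minimalAction, minimalAction, iInf_subtype', iInf_subtype',
    ENNReal.mul_iInf fun hC => absurd hC ENNReal.ofReal_ne_top]
  refine le_iInf fun μ => ?_
  refine (iInf_le _ ⟨μ.1, rotationFiber_subset g₁ g₂ h μ.2⟩).trans ?_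
  exact action_le_mul g₁ g₂ hC hle μ.1

lemma minimalAction_ne_top [CompactSpace M] (g₁ g₂ : Metric n M) {h : H1 M}
    (hfin : minimalAction g₁ h ≠ ⊤) : minimalAction g₂ h ≠ ⊤ :=
  ne_top_of_le_ne_top (ENNReal.mul_ne_top ENNReal.ofReal_ne_top hfin)
    (minimalAction_le_mul g₁ g₂ (distortion_nonneg g₁ g₂) (inner_le_distortion_mul g₁ g₂) hfin)

lemma beta_le_mul [CompactSpace M] (g₁ g₂ : Metric n M) {C : ℝ} (hC : 0 ≤ C)
    (hle : ∀ (x : M) (v : TangentSpace (𝓡 n) x), g₂.inner x v v ≤ C * g₁.inner x v v)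
    (h : H1 M) : beta g₂ h ≤ C * beta g₁ h := by
  change (minimalAction g₂ h).toReal ≤ C * (minimalAction g₁ h).toReal
  by_cases hfin : minimalAction g₁ h = ⊤
  -- Both infima are infinite, so both values of `beta` are the default `0`.
  · have : minimalAction g₂ h = ⊤ := by
      by_contra h2
      exact minimalAction_ne_top g₂ g₁ h2 hfin
    simp [hfin, this]
  · have := ENNReal.toReal_mono (ENNReal.mul_ne_top ENNReal.ofReal_ne_top hfin)
      (minimalAction_le_mul g₁ g₂ hC hle hfin)
    rwa [ENNReal.toReal_mul, ENNReal.toReal_ofReal hC] at this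

/-- Mather measures have finite action by definition, so there are none when `beta` takes its
default value. -/
lemma minimalAction_ne_top_of_mem {g : Metric n M} {h : H1 M}
    {μ : Measure (TangentBundle (𝓡 n) M)} (hμ : μ ∈ matherMeasures g h) :
    minimalAction g h ≠ ⊤ :=
  ne_top_of_le_ne_top (hμ.2 ▸ ENNReal.ofReal_ne_top) (minimalAction_le g hμ.1)

lemma action_eq_minimalAction {g : Metric n M} {h : H1 M}
    {μ : Measure (TangentBundle (𝓡 n) M)} (hμ : μ ∈ matherMeasures g h) :
    action g μ = minimalAction g h := by
  rw [hμ.2]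
  exact ENNReal.ofReal_toReal (minimalAction_ne_top_of_mem hμ)

lemma mem_matherMeasures_of_action_le {g : Metric n M} {h : H1 M}
    {μ : Measure (TangentBundle (𝓡 n) M)} (hμ : μ ∈ rotationFiber g h) {b : ℝ≥0∞} (hb : b ≠ ⊤)
    (hle : action g μ ≤ b) (hb' : b ≤ minimalAction g h) : μ ∈ matherMeasures g h := by
  have heq : action g μ = minimalAction g h :=
    (hle.trans hb').antisymm (minimalAction_le g hμ)
  refine ⟨hμ, heq.trans (ENNReal.ofReal_toReal ?_).symm⟩
  rw [← heq]
  exact ne_top_of_le_ne_top hb hle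

lemma eqOn_support_of_action_eq (g₁ g₂ : Metric n M) {C : ℝ} (hC : 0 ≤ C)
    (hle : ∀ (x : M) (v : TangentSpace (𝓡 n) x), g₂.inner x v v ≤ C * g₁.inner x v v)
    {μ : Measure (TangentBundle (𝓡 n) M)} (hfin : action g₂ μ ≠ ⊤)
    (heq : action g₂ μ = ENNReal.ofReal C * action g₁ μ) :
    ∀ p ∈ μ.support, g₂.inner p.1 p.2 p.2 = C * g₁.inner p.1 p.2 p.2 := by
  have h1 : (2 : ℝ≥0∞) * action g₂ μ = ENNReal.ofReal C * (2 * action g₁ μ) := by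
    rw [heq]; ring
  rw [← lintegral_inner_eq_two_mul_action, ← lintegral_inner_eq_two_mul_action,
    ← lintegral_const_mul _ g₁.measurable_inner.ennreal_ofReal] at h1
  have hae := ae_eq_of_ae_le_of_lintegral_le (μ := μ)
    (f := fun p => ENNReal.ofReal (g₂.inner p.1 p.2 p.2))
    (g := fun p => ENNReal.ofReal C * ENNReal.ofReal (g₁.inner p.1 p.2 p.2))
    (.of_forall fun p => by
      beta_reduce; rw [← ENNReal.ofReal_mul hC]; exact ENNReal.ofReal_le_ofReal (hle p.1 p.2))
    (by
      rw [lintegral_inner_eq_two_mul_action]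
      exact ENNReal.mul_ne_top (by simp) hfin)
    (g₁.measurable_inner.ennreal_ofReal.const_mul _).aemeasurable h1.ge
  have hclosed : IsClosed (X := TangentBundle (𝓡 n) M)
      {p | g₂.inner p.1 p.2 p.2 = C * g₁.inner p.1 p.2 p.2} :=
    isClosed_eq g₂.continuous_inner (continuous_const.mul g₁.continuous_inner)
  -- A closed set of full measure contains the support.
  refine Measure.support_subset_of_isClosed hclosed ?_
  filter_upwards [hae] with q hq
  rwa [← ENNReal.ofReal_mul hC, ENNReal.ofReal_eq_ofReal_iff (g₂.inner_nonneg _ _)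
    (mul_nonneg hC (g₁.inner_nonneg _ _))] at hq

lemma mem_matherMeasures_of_beta_eq [CompactSpace M] (g₁ g₂ : Metric n M) {C : ℝ} (hC : 0 ≤ C)
    (hle : ∀ (x : M) (v : TangentSpace (𝓡 n) x), g₂.inner x v v ≤ C * g₁.inner x v v)
    {h : H1 M} (heq : beta g₂ h = C * beta g₁ h) {μ : Measure (TangentBundle (𝓡 n) M)}
    (hμ : μ ∈ matherMeasures g₁ h) :
    μ ∈ matherMeasures g₂ h ∧
      ∀ p ∈ μ.support, g₂.inner p.1 p.2 p.2 = C * g₁.inner p.1 p.2 p.2 := by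
  have hfin := minimalAction_ne_top_of_mem hμ
  have hmul : minimalAction g₂ h = ENNReal.ofReal C * minimalAction g₁ h := by
    change (minimalAction g₂ h).toReal = C * (minimalAction g₁ h).toReal at heq
    rw [← ENNReal.ofReal_toReal (minimalAction_ne_top g₁ g₂ hfin), heq, ENNReal.ofReal_mul hC,
      ENNReal.ofReal_toReal hfin]
  have hact := action_le_mul g₁ g₂ hC hle μ
  rw [action_eq_minimalAction hμ] at hact
  have hmem : μ ∈ matherMeasures g₂ h :=
    mem_matherMeasures_of_action_le (rotationFiber_subset g₁ g₂ h hμ.1)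
      (ENNReal.mul_ne_top ENNReal.ofReal_ne_top hfin) hact hmul.ge
  refine ⟨hmem, eqOn_support_of_action_eq g₁ g₂ hC hle ?_ ?_⟩
  · rw [action_eq_minimalAction hmem]; exact minimalAction_ne_top g₁ g₂ hfin
  · rw [action_eq_minimalAction hmem, hmul, action_eq_minimalAction hμ]

/-- Prokhorov's theorem: `g(v, v)` has integral at most `2B`, so by Markov's inequality the mass
outside the compact set `g(v, v) ≤ j + 1` is at most `2B / (j + 1)`. -/
lemma isCompact_action_sublevel [T2Space M] [CompactSpace M] (g : Metric n M) {B : ℝ≥0∞}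
    (hB : B ≠ ⊤) : ∃ K : Set (ProbabilityMeasure (TangentBundle (𝓡 n) M)), IsCompact K ∧
      ∀ μ : ProbabilityMeasure (TangentBundle (𝓡 n) M), action g μ ≤ B → μ ∈ K := by
  lift B to NNReal using hB
  have hu : Tendsto (fun j : ℕ => 2 * B * (1 / (j + 1))) atTop (𝓝 0) := by
    simpa using (tendsto_one_div_add_atTop_nhds_zero_nat (𝕜 := NNReal)).const_mul (2 * B)
  have hmono : Monotone fun j : ℕ =>
      ({p | g.inner p.1 p.2 p.2 ≤ j + 1} : Set (TangentBundle (𝓡 n) M)) := by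
    intro i j hij p hp
    simp only [mem_ofPred_eq] at hp ⊢
    have : (i : ℝ) ≤ j := by exact_mod_cast hij
    linarith
  have hcomp := isCompact_setOfPred_probabilityMeasure_mass_eq_compl_isCompact_le hu
    (fun j : ℕ => g.isCompact_sublevel (j + 1)) (Or.inr hmono)
  refine ⟨_, hcomp, fun μ hμ j => ?_⟩
  have hmarkov := meas_ge_le_lintegral_div (μ := (μ : Measure (TangentBundle (𝓡 n) M)))
    g.measurable_inner.ennreal_ofReal.aemeasurable (ε := (j + 1 : ℝ≥0∞)) (by simp) (by simp)
  rw [lintegral_inner_eq_two_mul_action] at hmarkov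
  rw [← ENNReal.coe_le_coe, ProbabilityMeasure.ennreal_coeFn_eq_coeFn_toMeasure]
  refine (measure_mono ?_).trans (hmarkov.trans ?_)
  · intro p hp
    simp only [mem_compl_iff, mem_ofPred_eq, not_le] at hp ⊢
    rw [show (j + 1 : ℝ≥0∞) = ENNReal.ofReal (j + 1) by
      rw [ENNReal.ofReal_add (by positivity) zero_le_one]; simp]
    exact ENNReal.ofReal_le_ofReal hp.le
  · rw [one_div, ENNReal.coe_mul, ENNReal.coe_inv (by positivity), div_eq_mul_inv]
    push_cast
    gcongr

lemma mem_rotationFiber_of_tendsto [T2Space M] [CompactSpace M] (g : Metric n M) {h : H1 M}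
    {ι : Type*} {l : Filter ι} [l.NeBot] {μs : ι → ProbabilityMeasure (TangentBundle (𝓡 n) M)}
    {μ : ProbabilityMeasure (TangentBundle (𝓡 n) M)} (hμ : Tendsto μs l (𝓝 μ))
    (hmem : ∀ i, (μs i : Measure (TangentBundle (𝓡 n) M)) ∈ rotationFiber g h) {B : ℝ≥0∞}
    (hB : B ≠ ⊤) (hact : ∀ i, action g (μs i) ≤ B) :
    (μ : Measure (TangentBundle (𝓡 n) M)) ∈ rotationFiber g h := by
  -- A continuous fibrewise linear `ψ` satisfies `ψ² ≤ C g(v, v)`, so its integrals converge. Both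
  -- `df` and closed forms are of this kind.
  have hlim : ∀ ψ : TangentBundle (𝓡 n) M → ℝ, Continuous ψ →
      (∀ c p, ψ (scale c p) = c * ψ p) → Tendsto
        (fun i => ∫ p, ψ p ∂(μs i : Measure (TangentBundle (𝓡 n) M))) l
        (𝓝 (∫ p, ψ p ∂(μ : Measure (TangentBundle (𝓡 n) M)))) := by
    intro ψ hψ hhom
    obtain ⟨C, hC, hle⟩ := g.exists_le_mul_inner (hψ.pow 2) fun c p => by
      rw [Pi.pow_apply, hhom, mul_pow, Pi.pow_apply]
    refine tendsto_integral_of_sq_le hμ (L := fun p => C * g.inner p.1 p.2 p.2)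
      (continuous_const.mul g.continuous_inner)
      (B := (ENNReal.ofReal C * (2 * B)).toReal) (fun i => ?_) hψ hle
    rw [ENNReal.ofReal_toReal (ENNReal.mul_ne_top ENNReal.ofReal_ne_top
      (ENNReal.mul_ne_top (by simp) hB))]
    rw [lintegral_congr fun p => ENNReal.ofReal_mul hC,
      lintegral_const_mul _ g.measurable_inner.ennreal_ofReal,
      lintegral_inner_eq_two_mul_action]
    gcongr
    exact hact i
  have hactμ : action g (μ : Measure (TangentBundle (𝓡 n) M)) ≤ B :=
    lintegral_ofReal_le_of_tendsto hμ (continuous_const.mul g.continuous_inner)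
      (.of_forall hact)
  refine ⟨⟨inferInstance, ?_, fun f hf => ?_⟩, fun z hz η => ?_⟩
  · have hsq : ∀ p : TangentBundle (𝓡 n) M, ENNReal.ofReal √(g.inner p.1 p.2 p.2) ≤
        ENNReal.ofReal (g.inner p.1 p.2 p.2) + 1 := by
      intro p
      rw [← ENNReal.ofReal_one, ← ENNReal.ofReal_add (g.inner_nonneg _ _) zero_le_one]
      refine ENNReal.ofReal_le_ofReal ?_
      nlinarith [Real.sq_sqrt (g.inner_nonneg p.1 p.2), Real.sqrt_nonneg (g.inner p.1 p.2 p.2),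
        sq_nonneg (√(g.inner p.1 p.2 p.2) - 1)]
    refine (lintegral_mono hsq).trans_lt ?_
    rw [lintegral_add_right _ measurable_const, lintegral_inner_eq_two_mul_action]
    simp only [lintegral_const, measure_univ, mul_one]
    exact ENNReal.add_lt_top.2 ⟨(ENNReal.mul_ne_top (by simp)
      (ne_top_of_le_ne_top hB hactμ)).lt_top, by simp⟩
  · refine tendsto_nhds_unique (hlim _ (continuous_differential hf) fun c p => ?_) ?_
    · exact (mfderiv (𝓡 n) 𝓘(ℝ, ℝ) f p.1).map_smul c p.2
    · simp only [(hmem _).1.closed f hf]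
      exact tendsto_const_nhds
  · refine tendsto_nhds_unique (hlim _ η.continuous fun c p => ?_) ?_
    · exact (η.toFun p.1).map_smul c p.2
    · simp only [(hmem _).2 z hz η]
      exact tendsto_const_nhds

lemma matherMeasures_nonempty [T2Space M] [CompactSpace M] (g : Metric n M) {h : H1 M}
    (hfin : minimalAction g h ≠ ⊤) : (matherMeasures g h).Nonempty := by
  have hseq : ∀ k : ℕ, ∃ μ ∈ rotationFiber g h,
      action g μ < minimalAction g h + ((k : ℝ≥0∞) + 1)⁻¹ := by
    intro k
    have := ENNReal.lt_add_right hfin (b := ((k : ℝ≥0∞) + 1)⁻¹) (by simp)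
    conv_lhs at this => rw [minimalAction]
    simpa only [iInf_lt_iff, exists_prop] using this
  choose ν hν hνlt using hseq
  let μs : ℕ → ProbabilityMeasure (TangentBundle (𝓡 n) M) :=
    fun k => ⟨ν k, (hν k).1.isProbabilityMeasure⟩
  have hB : minimalAction g h + 1 ≠ ⊤ := by simp [hfin]
  have hact : ∀ k, action g (μs k) ≤ minimalAction g h + 1 := fun k => by
    refine (hνlt k).le.trans ?_
    gcongr
    simp
  obtain ⟨K, hK, hKmem⟩ := isCompact_action_sublevel g hB
  -- A limit along an ultrafilter replaces a convergent subsequence, so compactness alone suffices.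
  obtain ⟨μ, -, hμ⟩ := hK.ultrafilter_le_nhds ((hyperfilter ℕ).map μs)
    (by
      rw [Ultrafilter.coe_map, Filter.le_principal_iff, Filter.mem_map]
      exact Filter.univ_mem' fun k => hKmem _ (hact k))
  have hμ' : Tendsto μs (hyperfilter ℕ : Filter ℕ) (𝓝 μ) := hμ
  have hmem := mem_rotationFiber_of_tendsto g hμ' hν hB hact
  refine ⟨μ, mem_matherMeasures_of_action_le hmem hfin ?_ le_rfl⟩
  refine ENNReal.le_of_forall_pos_le_add fun ε hε _ => ?_
  refine lintegral_ofReal_le_of_tendsto hμ' (continuous_const.mul g.continuous_inner) ?_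
  refine Filter.Eventually.filter_mono Nat.hyperfilter_le_atTop ?_
  have hlim : Tendsto (fun k : ℕ => ((k : ℝ≥0∞) + 1)⁻¹) atTop (𝓝 0) := by
    have := (tendsto_add_atTop_iff_nat 1).2 ENNReal.tendsto_inv_nat_nhds_zero
    simpa using this
  filter_upwards [hlim.eventually_lt_const (u := (ε : ℝ≥0∞)) (by simpa using hε)] with k hk
  refine (hνlt k).le.trans ?_
  gcongr

lemma beta_eq_of_eqOn_matherSet [T2Space M] [CompactSpace M] (g₁ g₂ : Metric n M) {C : ℝ}
    (hC : 0 ≤ C) {h : H1 M} (hsub : matherMeasures g₁ h ⊆ matherMeasures g₂ h)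
    (heq : ∀ p ∈ matherSet g₁ h, g₂.inner p.1 p.2 p.2 = C * g₁.inner p.1 p.2 p.2) :
    beta g₂ h = C * beta g₁ h := by
  change (minimalAction g₂ h).toReal = C * (minimalAction g₁ h).toReal
  by_cases hfin : minimalAction g₁ h = ⊤
  · have : minimalAction g₂ h = ⊤ := by
      by_contra h2
      exact minimalAction_ne_top g₂ g₁ h2 hfin
    simp [hfin, this]
  · obtain ⟨μ, hμ⟩ := matherMeasures_nonempty g₁ hfin
    rw [← action_eq_minimalAction hμ, ← action_eq_minimalAction (hsub hμ)]
    have := secondCountableTopology_tangentBundle g₁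
    have hae : ∀ᵐ p ∂μ, g₂.inner p.1 p.2 p.2 = C * g₁.inner p.1 p.2 p.2 := by
      filter_upwards [Measure.support_mem_ae (μ := μ)] with p hp
      exact heq p (mem_iUnion₂.2 ⟨μ, hμ, hp⟩)
    have : action g₂ μ = ENNReal.ofReal C * action g₁ μ := by
      rw [action, action,
        ← lintegral_const_mul _ (measurable_lagrangian g₁)]
      refine lintegral_congr_ae ?_
      filter_upwards [hae] with p hp
      rw [← ENNReal.ofReal_mul hC, lagrangian, lagrangian, hp]
      congr 1
      ring
    rw [this, ENNReal.toReal_mul, ENNReal.toReal_ofReal hC]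

end MatherBeta

/-! ### Mather measures do not charge the zero section. -/

namespace MatherBeta

variable {n : ℕ} {M : Type u} [TopologicalSpace M]
  [ChartedSpace (EuclideanSpace ℝ (Fin n)) M] [IsManifold (𝓡 n) ∞ M]

lemma measurableSet_zeroSection (g : Metric n M) :
    MeasurableSet (α := TangentBundle (𝓡 n) M) {p | p.2 = 0} := by
  have : ({p | p.2 = 0} : Set (TangentBundle (𝓡 n) M)) =
      (fun p : TangentBundle (𝓡 n) M => g.inner p.1 p.2 p.2) ⁻¹' {0} := by
    ext p
    exact g.inner_eq_zero_iff.symm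
  rw [this]
  exact g.measurable_inner (measurableSet_singleton 0)

/-- The measure obtained from `μ` by removing its part on the zero section, normalising, and
scaling the vectors by the mass of the remaining part. -/
noncomputable def dropZeroSection (μ : Measure (TangentBundle (𝓡 n) M)) :
    Measure (TangentBundle (𝓡 n) M) :=
  Measure.map (scale (μ {p | p.2 = 0}ᶜ).toReal)
    ((μ {p | p.2 = 0}ᶜ)⁻¹ • μ.restrict {p | p.2 = 0}ᶜ)

section dropZeroSection

variable {μ : Measure (TangentBundle (𝓡 n) M)}

lemma isProbabilityMeasure_dropZeroSection [IsProbabilityMeasure μ]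
    (h0 : μ {p | p.2 = 0}ᶜ ≠ 0) : IsProbabilityMeasure (dropZeroSection μ) := by
  have : IsProbabilityMeasure ((μ {p | p.2 = 0}ᶜ)⁻¹ • μ.restrict {p | p.2 = 0}ᶜ) := by
    constructor
    rw [Measure.smul_apply, Measure.restrict_apply_univ, smul_eq_mul,
      ENNReal.inv_mul_cancel h0 (measure_ne_top _ _)]
  exact Measure.isProbabilityMeasure_map (continuous_scale _).aemeasurable

/-- The scaling factor cancels the normalising factor, and the integrand vanishes on the removed
part. -/
lemma integral_dropZeroSection [IsProbabilityMeasure μ]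
    (h0 : μ {p | p.2 = 0}ᶜ ≠ 0) {ψ : TangentBundle (𝓡 n) M → ℝ} (hψ : Continuous ψ)
    (hhom : ∀ c p, ψ (scale c p) = c * ψ p) (hzero : ∀ p, p.2 = 0 → ψ p = 0) :
    ∫ p, ψ p ∂(dropZeroSection μ) = ∫ p, ψ p ∂μ := by
  have ht : (μ {p | p.2 = 0}ᶜ).toReal ≠ 0 :=
    ENNReal.toReal_ne_zero.2 ⟨h0, measure_ne_top _ _⟩
  rw [dropZeroSection, integral_map (continuous_scale _).aemeasurable
    hψ.measurable.aestronglyMeasurable, integral_smul_measure]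
  simp_rw [hhom]
  rw [integral_const_mul, ENNReal.toReal_inv, smul_eq_mul, inv_mul_cancel_left₀ ht]
  refine setIntegral_eq_integral_of_forall_compl_eq_zero fun p hp => hzero p ?_
  simpa using hp

/-- Scaling by the remaining mass `t` contributes `t ^ (k + 1)` and normalising contributes `t⁻¹`.
The moment uses `k = 0`, the action `k = 1`. -/
lemma lintegral_dropZeroSection [IsProbabilityMeasure μ]
    (h0 : μ {p | p.2 = 0}ᶜ ≠ 0) {ψ : TangentBundle (𝓡 n) M → ℝ} (hψ : Continuous ψ) (k : ℕ)
    (hhom : ∀ c, 0 ≤ c → ∀ p, ψ (scale c p) = c ^ (k + 1) * ψ p) :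
    ∫⁻ p, ENNReal.ofReal (ψ p) ∂(dropZeroSection μ) ≤
      μ {p | p.2 = 0}ᶜ ^ k * ∫⁻ p, ENNReal.ofReal (ψ p) ∂μ := by
  have htop : μ {p | p.2 = 0}ᶜ ≠ ⊤ := measure_ne_top _ _
  rw [dropZeroSection, lintegral_map hψ.measurable.ennreal_ofReal (continuous_scale _).measurable,
    lintegral_smul_measure]
  have : ∀ p : TangentBundle (𝓡 n) M, ENNReal.ofReal (ψ (scale (μ {p | p.2 = 0}ᶜ).toReal p)) =
      μ {p | p.2 = 0}ᶜ ^ (k + 1) * ENNReal.ofReal (ψ p) := by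
    intro p
    rw [hhom _ ENNReal.toReal_nonneg, ENNReal.ofReal_mul (by positivity), ENNReal.ofReal_pow
      ENNReal.toReal_nonneg, ENNReal.ofReal_toReal htop]
  rw [lintegral_congr this, lintegral_const_mul _ hψ.measurable.ennreal_ofReal, smul_eq_mul,
    pow_succ', mul_assoc, ← mul_assoc, ENNReal.inv_mul_cancel h0 htop, one_mul]
  gcongr
  exact Measure.restrict_le_self

lemma inner_scale (g : Metric n M) (c : ℝ) (p : TangentBundle (𝓡 n) M) :
    g.inner (scale c p).1 (scale c p).2 (scale c p).2 = c ^ 2 * g.inner p.1 p.2 p.2 :=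
  g.inner_smul_smul p.1 c p.2

lemma dropZeroSection_mem_rotationFiber (g : Metric n M) {h : H1 M}
    (hμ : μ ∈ rotationFiber g h) (h0 : μ {p | p.2 = 0}ᶜ ≠ 0) :
    dropZeroSection μ ∈ rotationFiber g h := by
  obtain ⟨⟨hprob, hmom, hcl⟩, hrot⟩ := hμ
  refine ⟨⟨isProbabilityMeasure_dropZeroSection h0, ?_, fun f hf => ?_⟩, fun z hz η => ?_⟩
  · refine (lintegral_dropZeroSection h0 g.continuous_inner.sqrt 0 fun c hc p => ?_).trans_lt ?_
    · rw [inner_scale, Real.sqrt_mul (sq_nonneg c), Real.sqrt_sq hc, zero_add, pow_one]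
    · simpa using hmom
  · rw [integral_dropZeroSection h0 (continuous_differential hf)
      (fun c p => (mfderiv (𝓡 n) 𝓘(ℝ, ℝ) f p.1).map_smul c p.2) fun p hp => ?_, hcl f hf]
    rw [differential, hp]
    exact map_zero _
  · rw [integral_dropZeroSection h0 η.continuous
      (fun c p => (η.toFun p.1).map_smul c p.2) fun p hp => ?_, hrot z hz η]
    rw [hp, map_zero]

end dropZeroSection

/-- A Mather measure whose class pairs nontrivially with some closed 1-form does not charge the
zero section. -/
lemma measure_zeroSection_eq_zero (g : Metric n M) {h : H1 M} {z : (singularChains M).cycles 1}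
    (hz : (singularChains M).homologyπ 1 z = h) {η : ClosedOneForm n M}
    (hη : (chainIntegral η ((singularChains M).iCycles 1 z) : ULift.{u} ℝ).down ≠ 0)
    {μ : Measure (TangentBundle (𝓡 n) M)} (hμ : μ ∈ matherMeasures g h) :
    μ {p | p.2 = 0} = 0 := by
  have hprob := hμ.1.1.isProbabilityMeasure
  have hmeas := measurableSet_zeroSection g
  have h0 : μ {p | p.2 = 0}ᶜ ≠ 0 := by
    intro h0
    rw [← hμ.1.2 z hz η] at hη
    refine hη (integral_eq_zero_of_ae ?_)
    filter_upwards [(measure_eq_zero_iff_ae_notMem.1 h0)] with p hp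
    have hp' : p.2 = 0 := by simpa using hp
    rw [hp', map_zero, Pi.zero_apply]
  have hfin := minimalAction_ne_top_of_mem hμ
  have hact := action_eq_minimalAction hμ
  -- The modified measure is a competitor of action at most `t` times the minimum; as the minimum is
  -- positive and finite, `t = 1`.
  have hle : minimalAction g h ≤ μ {p | p.2 = 0}ᶜ * minimalAction g h := by
    have h1 := lintegral_dropZeroSection h0 (ψ := lagrangian g)
      (continuous_const.mul g.continuous_inner) 1 fun c _ p => by
        rw [lagrangian, inner_scale, lagrangian]; ring
    rw [pow_one] at h1
    rw [← hact]
    exact hact.le.trans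
      ((minimalAction_le g (dropZeroSection_mem_rotationFiber g hμ.1 h0)).trans h1)
  have hpos : minimalAction g h ≠ 0 := by
    rw [← hact]
    intro hzero
    rw [action, lintegral_eq_zero_iff (measurable_lagrangian g)] at hzero
    refine h0 (measure_eq_zero_iff_ae_notMem.2 ?_)
    filter_upwards [hzero] with p hp
    rw [Pi.zero_apply, ENNReal.ofReal_eq_zero, lagrangian] at hp
    simp only [mem_compl_iff, mem_ofPred_eq, not_not]
    refine g.inner_eq_zero_iff.1 (le_antisymm ?_ (g.inner_nonneg _ _))
    linarith
  have hone : μ {p | p.2 = 0}ᶜ = 1 := by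
    refine le_antisymm prob_le_one ?_
    by_contra hlt
    rw [not_le] at hlt
    have := ENNReal.mul_lt_mul_left hpos hfin hlt
    rw [one_mul] at this
    exact absurd hle this.not_ge
  exact (prob_compl_eq_one_iff hmeas).1 hone

/-- If a Mather measure does not charge the zero section, then two conformal metrics that agree up
to the factor `m` on its support have conformal factor `m` over its support. -/
lemma conformalFactor_eq_of_mem_support [CompactSpace M] (g₁ g₂ : Metric n M) {φ : M → ℝ}
    (hφ : Continuous φ)
    (hconf : ∀ (x : M) (v w : TangentSpace (𝓡 n) x), g₂.inner x v w = φ x * g₁.inner x v w)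
    {μ : Measure (TangentBundle (𝓡 n) M)} (h0 : μ {p | p.2 = 0} = 0) {m : ℝ}
    (heq : ∀ p ∈ μ.support, g₂.inner p.1 p.2 p.2 = m * g₁.inner p.1 p.2 p.2) :
    ∀ p ∈ μ.support, φ p.1 = m := by
  have := secondCountableTopology_tangentBundle g₁
  have hclosed : IsClosed (X := TangentBundle (𝓡 n) M) {p | φ p.1 = m} :=
    isClosed_eq (hφ.comp continuous_tangentBundle_proj) continuous_const
  -- Cancellation needs `v ≠ 0`, which holds almost everywhere; closedness of `φ = m` then covers
  -- the zero vectors in the support.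
  refine Measure.support_subset_of_isClosed hclosed ?_
  filter_upwards [Measure.support_mem_ae (μ := μ), measure_eq_zero_iff_ae_notMem.1 h0] with p hp hp0
  have h1 := heq p hp
  rw [hconf] at h1
  exact mul_right_cancel₀ (g₁.pos p.1 p.2 hp0).ne' h1

end MatherBeta

/-! ### Real singular chains and cochains in degree one. -/

namespace MatherBeta
variable {M : Type u} [TopologicalSpace M]

/-- The singular 1-simplex of a path. -/
noncomputable def pathSimplex (γ : C(unitInterval, M)) : (singularSet M) _⦋1⦌ :=
  ((TopCat.of M).toSSetObjEquiv _).symm (γ.comp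
    ⟨stdSimplexHomeomorphUnitInterval, stdSimplexHomeomorphUnitInterval.continuous⟩)

lemma pathSimplex_simplexPath (σ : (singularSet M) _⦋1⦌) : pathSimplex (simplexPath σ) = σ := by
  rw [pathSimplex, Equiv.symm_apply_eq]
  ext s
  simp [simplexPath]

/-- The edge of a singular 2-simplex from the vertex `i` to the vertex `j`. -/
noncomputable def edgePath (τ : C(stdSimplex ℝ (Fin 3), M)) (i j : Fin 3) : C(unitInterval, M) :=
  ⟨fun t => τ ⟨fun k => (1 - (t : ℝ)) * (if k = i then 1 else 0) + t * (if k = j then 1 else 0), by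
    refine ⟨fun k => ?_, ?_⟩
    · have h0 := t.2.1
      have h1 := t.2.2
      beta_reduce
      split_ifs <;> nlinarith
    · simp [Finset.sum_add_distrib]⟩, by fun_prop⟩

lemma stdSimplex_map_succAbove_apply (i : Fin 3) (s : stdSimplex ℝ (Fin 2)) (k : Fin 3) :
    stdSimplex.map i.succAbove s k =
      (1 - s 1) * (if k = i.succAbove 0 then 1 else 0) +
        s 1 * (if k = i.succAbove 1 then 1 else 0) := by
  have hs : 1 - s 1 = s 0 := by linarith [stdSimplex.add_eq_one s]
  rw [stdSimplex.map_coe, FunOnFinite.linearMap_apply_apply, hs, Finset.sum_filter,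
    Fin.sum_univ_two]
  simp only [eq_comm (a := k), mul_ite, mul_one, mul_zero]

lemma delta_eq_pathSimplex (τ : C(stdSimplex ℝ (Fin 3), M)) (i : Fin 3) :
    (singularSet M).δ i (((TopCat.of M).toSSetObjEquiv (Opposite.op ⦋2⦌)).symm τ) =
      pathSimplex (edgePath τ (i.succAbove 0) (i.succAbove 1)) := by
  rw [pathSimplex, Equiv.eq_symm_apply]
  ext s
  refine congrArg τ (stdSimplex.ext (funext fun k => ?_))
  exact stdSimplex_map_succAbove_apply i s k

lemma coeff_hom_ext {f g : coeff.{u} ⟶ coeff.{u}}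
    (h : (f (⟨1⟩ : ULift.{u} ℝ) : ULift.{u} ℝ).down = (g (⟨1⟩ : ULift.{u} ℝ) : ULift.{u} ℝ).down) :
    f = g := by
  have key : ∀ (k : coeff.{u} ⟶ coeff.{u}) (x : ℝ), (k (⟨x⟩ : ULift.{u} ℝ) : ULift.{u} ℝ).down =
      x * (k (⟨1⟩ : ULift.{u} ℝ) : ULift.{u} ℝ).down := by
    intro k x
    have : (⟨x⟩ : ULift.{u} ℝ) = x • (⟨1⟩ : ULift.{u} ℝ) := by
      ext; simp
    rw [this]
    exact congrArg ULift.down (k.hom.map_smul x _)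
  ext x
  exact (key f x.down).trans ((congrArg (x.down * ·) h).trans (key g x.down).symm)

section SimplexChain

variable (X : SSet.{u})

/-- The chain given by one simplex of a simplicial set, with coefficient `1`. -/
noncomputable def unitChain {k : ℕ} (σ : X _⦋k⦌) : (X.chainComplex coeff.{u}).X k :=
  (X.ιChainComplex σ : coeff.{u} ⟶ _) (⟨1⟩ : ULift.{u} ℝ)

lemma d_unitChain_two (τ : X _⦋2⦌) :
    (X.chainComplex coeff.{u}).d 2 1 (unitChain X τ) =
      unitChain X (X.δ 0 τ) - unitChain X (X.δ 1 τ) + unitChain X (X.δ 2 τ) := by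
  have h := X.ιChainComplex_d (n := 1) (R := coeff.{u}) τ
  rw [Fin.sum_univ_three] at h
  have h' := congrArg (fun k => k.hom (⟨1⟩ : ULift.{u} ℝ)) h
  refine h'.trans ?_
  simp [unitChain, sub_eq_add_neg]

lemma d_unitChain_one (σ : X _⦋1⦌) :
    (X.chainComplex coeff.{u}).d 1 0 (unitChain X σ) =
      unitChain X (X.δ 0 σ) - unitChain X (X.δ 1 σ) := by
  have h := X.ιChainComplex_d (n := 0) (R := coeff.{u}) σ
  rw [Fin.sum_univ_two] at h
  have h' := congrArg (fun k => k.hom (⟨1⟩ : ULift.{u} ℝ)) h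
  refine h'.trans ?_
  simp [unitChain, sub_eq_add_neg]

lemma chain_hom_ext {k : ℕ} {f g : (X.chainComplex coeff.{u}).X k ⟶ coeff.{u}}
    (h : ∀ σ : X _⦋k⦌, (f (unitChain X σ) : ULift.{u} ℝ).down =
      (g (unitChain X σ) : ULift.{u} ℝ).down) : f = g := by
  refine SSet.chainComplex_hom_ext fun σ => coeff_hom_ext (h σ)

lemma desc_unitChain {k : ℕ} (a : X _⦋k⦌ → ℝ) (σ : X _⦋k⦌) :
    (Limits.Cofan.IsColimit.desc (X.isColimitChainComplexXCofan coeff.{u} k)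
      (fun σ => a σ • 𝟙 coeff.{u}) (unitChain X σ) : ULift.{u} ℝ).down = a σ := by
  have h := Limits.Cofan.IsColimit.fac (X.isColimitChainComplexXCofan coeff.{u} k)
      (fun σ => a σ • 𝟙 coeff.{u}) σ
  have h' := congrArg (fun k => (k.hom (⟨1⟩ : ULift.{u} ℝ) : ULift.{u} ℝ).down) h
  refine h'.trans ?_
  simp

end SimplexChain

/-- The value of a real 1-cochain on the singular simplex of a path. -/
noncomputable def cochainValue (ℓ : (singularChains M).X 1 ⟶ coeff.{u}) (γ : C(unitInterval, M)) :
    ℝ :=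
  (ℓ (unitChain (singularSet M) (pathSimplex γ)) : ULift.{u} ℝ).down

/-- The cocycle vanishes on the boundary of `τ`, whose faces 0, 1, 2 are the edges 12, 02, 01. -/
lemma cochainValue_triangle {ℓ : (singularChains M).X 1 ⟶ coeff.{u}}
    (hℓ : (singularChains M).d 2 1 ≫ ℓ = 0) (τ : C(stdSimplex ℝ (Fin 3), M)) :
    cochainValue ℓ (edgePath τ 0 2) =
      cochainValue ℓ (edgePath τ 0 1) + cochainValue ℓ (edgePath τ 1 2) := by
  have h1 := d_unitChain_two (singularSet M)
    (((TopCat.of M).toSSetObjEquiv (Opposite.op ⦋2⦌)).symm τ)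
  rw [delta_eq_pathSimplex, delta_eq_pathSimplex, delta_eq_pathSimplex] at h1
  have h2 : ℓ.hom ((singularChains M).d 2 1 (unitChain (singularSet M)
      (((TopCat.of M).toSSetObjEquiv (Opposite.op ⦋2⦌)).symm τ))) = 0 :=
    congrArg (fun k => k.hom (unitChain (singularSet M)
      (((TopCat.of M).toSSetObjEquiv (Opposite.op ⦋2⦌)).symm τ))) hℓ
  have h3 := (congrArg ℓ.hom h1).symm.trans h2
  have h4 := (((ℓ.hom.map_add _ _).trans (congrArg (· + _) (ℓ.hom.map_sub _ _))).symm.trans h3)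
  have h5 := congrArg ULift.down h4
  have h6 : cochainValue ℓ (edgePath τ 1 2) - cochainValue ℓ (edgePath τ 0 2) +
    cochainValue ℓ (edgePath τ 0 1) = 0 := h5
  linarith

lemma stdSimplexHomeomorphUnitInterval_map_succAbove (i : Fin 2) (s : stdSimplex ℝ (Fin 1)) :
    stdSimplexHomeomorphUnitInterval (stdSimplex.map i.succAbove s) = if i = 0 then 1 else 0 := by
  rw [Subsingleton.elim s (stdSimplex.vertex 0), stdSimplex.map_vertex]
  fin_cases i <;> rfl

/-- A closed 1-cochain and the integration of a closed 1-form agree on cycles as soon as they agree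
on paths up to the difference of the values of a function at the end points. -/
lemma chainIntegral_iCycles_eq {n : ℕ} [ChartedSpace (EuclideanSpace ℝ (Fin n)) M]
    [IsManifold (𝓡 n) ∞ M] {ℓ : (singularChains M).X 1 ⟶ coeff.{u}} {η : ClosedOneForm n M}
    {G : M → ℝ} (hG : ∀ γ : C(unitInterval, M),
      pathIntegral η γ = cochainValue ℓ γ - (G (γ 1) - G (γ 0)))
    (z : (singularChains M).cycles 1) :
    chainIntegral η ((singularChains M).iCycles 1 z) = ℓ ((singularChains M).iCycles 1 z) := by
  let a : (singularSet M) _⦋0⦌ → ℝ := fun x => G (TopCat.toSSetObj₀Equiv x)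
  let k : (singularChains M).X 0 ⟶ coeff.{u} :=
    Limits.Cofan.IsColimit.desc ((singularSet M).isColimitChainComplexXCofan coeff.{u} 0)
      (fun x => a x • 𝟙 coeff.{u})
  -- The cochains differ by the coboundary of `G`, which vanishes on cycles.
  have key : ℓ = chainIntegral η + (singularChains M).d 1 0 ≫ k := by
    refine chain_hom_ext (singularSet M) fun σ => ?_
    have h1 := desc_unitChain (singularSet M) (fun σ => pathIntegral η (simplexPath σ)) σ
    have h2 := d_unitChain_one (singularSet M) σ
    have h3 : (k.hom ((singularChains M).d 1 0 (unitChain (singularSet M) σ))).down =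
        a ((singularSet M).δ 0 σ) - a ((singularSet M).δ 1 σ) := by
      have h4 := congrArg ULift.down ((congrArg k.hom h2).trans (k.hom.map_sub _ _))
      refine h4.trans ?_
      exact congrArg₂ (· - ·) (desc_unitChain (singularSet M) a _)
        (desc_unitChain (singularSet M) a _)
    have h5 : (ℓ.hom (unitChain (singularSet M) σ)).down =
        pathIntegral η (simplexPath σ) +
          (a ((singularSet M).δ 0 σ) - a ((singularSet M).δ 1 σ)) := by
      have h6 := hG (simplexPath σ)
      rw [cochainValue, pathSimplex_simplexPath] at h6
      have h7 : a ((singularSet M).δ 0 σ) = G (simplexPath σ 1) := by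
        refine congrArg (fun s => G ((TopCat.of M).toSSetObjEquiv _ σ s)) ?_
        exact (Homeomorph.eq_symm_apply _).2 (stdSimplexHomeomorphUnitInterval_map_succAbove 0 _)
      have h8 : a ((singularSet M).δ 1 σ) = G (simplexPath σ 0) := by
        refine congrArg (fun s => G ((TopCat.of M).toSSetObjEquiv _ σ s)) ?_
        exact (Homeomorph.eq_symm_apply _).2 (stdSimplexHomeomorphUnitInterval_map_succAbove 1 _)
      rw [h7, h8, h6]
      exact (sub_add_cancel _ _).symm
    refine h5.trans ?_
    refine Eq.trans ?_ (congrArg₂ (· + ·) h1 h3).symm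
    rfl
  have h0 : ((singularChains M).d 1 0 ((singularChains M).iCycles 1 z)) = 0 := by
    rw [← ModuleCat.comp_apply, HomologicalComplex.iCycles_d]
    rfl
  have h9 := congrArg (fun f => f.hom ((singularChains M).iCycles 1 z)) key
  refine Eq.trans ?_ h9.symm
  have h10 : k.hom ((singularChains M).d 1 0 ((singularChains M).iCycles 1 z)) = 0 := by
    rw [h0]; exact map_zero _
  exact ((congrArg ((chainIntegral η).hom ((singularChains M).iCycles 1 z) + ·) h10).trans
    (add_zero _)).symm

/-- A cycle that is not a boundary is separated from the subspace of boundaries by a linear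
functional. -/
lemma exists_functional_of_ne_zero {h : H1 M} (hh : h ≠ 0) :
    ∃ z : (singularChains M).cycles 1, (singularChains M).homologyπ 1 z = h ∧
      ∃ ℓ : (singularChains M).X 1 ⟶ coeff.{u}, (singularChains M).d 2 1 ≫ ℓ = 0 ∧
        (ℓ ((singularChains M).iCycles 1 z) : ULift.{u} ℝ).down ≠ 0 := by
  obtain ⟨z, hz⟩ := (ModuleCat.epi_iff_surjective _).1
    (inferInstance : Epi ((singularChains M).homologyπ 1)) h
  refine ⟨z, hz, ?_⟩
  have hnot : (singularChains M).iCycles 1 z ∉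
      LinearMap.range ((singularChains M).d 2 1).hom := by
    rintro ⟨w, hw⟩
    apply hh
    have : z = (singularChains M).toCycles 2 1 w := by
      apply (ModuleCat.mono_iff_injective ((singularChains M).iCycles 1)).1 inferInstance
      rw [← ModuleCat.comp_apply, HomologicalComplex.toCycles_i]
      exact hw.symm
    rw [← hz, this, ← ModuleCat.comp_apply, HomologicalComplex.toCycles_comp_homologyπ]
    rfl
  obtain ⟨f, hf, hle⟩ := Submodule.exists_le_ker_of_notMem hnot
  refine ⟨ModuleCat.ofHom (ULift.moduleEquiv.symm.toLinearMap ∘ₗ f), ?_, ?_⟩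
  · ext w
    have : f (((singularChains M).d 2 1) w) = 0 := hle ⟨w, rfl⟩
    exact this
  · exact hf

end MatherBeta

/-! ### Closed cochains on paths and their local primitives. -/

namespace MatherBeta

section Cochain

variable {M : Type u} [TopologicalSpace M]

/-- The affine reparametrisation of the part of a path between two parameters. -/
noncomputable def subpath (γ : C(unitInterval, M)) (a b : unitInterval) : C(unitInterval, M) :=
  ⟨fun t => γ ⟨(1 - (t : ℝ)) * a + t * b, by
    have := convex_Icc (0 : ℝ) 1 a.2 b.2 (sub_nonneg.2 t.2.2) t.2.1 (sub_add_cancel _ _)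
    simpa using this⟩, by fun_prop⟩

lemma subpath_zero_one (γ : C(unitInterval, M)) : subpath γ 0 1 = γ := by
  ext t
  refine congrArg γ (Subtype.ext ?_)
  simp

lemma subpath_mem {γ : C(unitInterval, M)} {a b : unitInterval} {U : Set M}
    (h : ∀ s ∈ uIcc a b, γ s ∈ U) (t : unitInterval) : subpath γ a b t ∈ U := by
  refine h _ ?_
  have ht0 := t.2.1
  have ht1 := t.2.2
  rw [mem_uIcc, ← Subtype.coe_le_coe, ← Subtype.coe_le_coe, ← Subtype.coe_le_coe,
    ← Subtype.coe_le_coe]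
  dsimp only
  rcases le_total (a : ℝ) b with hab | hab
  · left; constructor <;> nlinarith
  · right; constructor <;> nlinarith

variable {ℓ : (singularChains M).X 1 ⟶ coeff.{u}}

/-- Apply the triangle identity to the 2-simplex mapped affinely onto the parameters `a, b, c`, in
any order, then by `γ`. -/
lemma cochainValue_subpath_add (hℓ : (singularChains M).d 2 1 ≫ ℓ = 0)
    (γ : C(unitInterval, M)) (a b c : unitInterval) :
    cochainValue ℓ (subpath γ a c) =
      cochainValue ℓ (subpath γ a b) + cochainValue ℓ (subpath γ b c) := by
  have hmem : ∀ s : stdSimplex ℝ (Fin 3), s 0 * a + s 1 * b + s 2 * c ∈ unitInterval := by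
    intro s
    have h0 := s.2.1
    have h1 : s 0 + s 1 + s 2 = 1 := by
      have := stdSimplex.sum_eq_one s
      rwa [Fin.sum_univ_three] at this
    constructor
    · have := mul_nonneg (h0 0) a.2.1
      have := mul_nonneg (h0 1) b.2.1
      have := mul_nonneg (h0 2) c.2.1
      exact add_nonneg (add_nonneg ‹_› ‹_›) ‹_›
    · have h2 := mul_le_of_le_one_right (h0 0) a.2.2
      have h3 := mul_le_of_le_one_right (h0 1) b.2.2
      have h4 := mul_le_of_le_one_right (h0 2) c.2.2
      exact (add_le_add (add_le_add h2 h3) h4).trans h1.le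
  have hcont : Continuous fun s : stdSimplex ℝ (Fin 3) => s 0 * a + s 1 * b + s 2 * c := by
    have hc (i : Fin 3) : Continuous fun s : stdSimplex ℝ (Fin 3) => s i :=
      (continuous_apply i).comp continuous_subtype_val
    exact (((hc 0).mul continuous_const).add ((hc 1).mul continuous_const)).add
      ((hc 2).mul continuous_const)
  let τ : C(stdSimplex ℝ (Fin 3), M) := ⟨fun s => γ ⟨_, hmem s⟩, by fun_prop⟩
  have h := cochainValue_triangle hℓ τ
  have h01 : edgePath τ 0 1 = subpath γ a b := by
    ext t
    refine congrArg γ (Subtype.ext ?_)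
    change ((1 - (t : ℝ)) * _ + t * _) * a + ((1 - (t : ℝ)) * _ + t * _) * b +
      ((1 - (t : ℝ)) * _ + t * _) * c = _
    simp
  have h02 : edgePath τ 0 2 = subpath γ a c := by
    ext t
    refine congrArg γ (Subtype.ext ?_)
    change ((1 - (t : ℝ)) * _ + t * _) * a + ((1 - (t : ℝ)) * _ + t * _) * b +
      ((1 - (t : ℝ)) * _ + t * _) * c = _
    simp
  have h12 : edgePath τ 1 2 = subpath γ b c := by
    ext t
    refine congrArg γ (Subtype.ext ?_)
    change ((1 - (t : ℝ)) * _ + t * _) * a + ((1 - (t : ℝ)) * _ + t * _) * b +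
      ((1 - (t : ℝ)) * _ + t * _) * c = _
    simp
  rwa [h01, h02, h12] at h

/-- The cone over a path in a normed space, as a map on the standard 2-simplex. -/
lemma continuous_cone {E : Type*} [NormedAddCommGroup E] [NormedSpace ℝ E] {Γ : ℝ → E}
    (hΓ : Continuous Γ) {R : ℝ} (hR : ∀ t, ‖Γ t‖ ≤ R) :
    Continuous fun s : stdSimplex ℝ (Fin 3) => (s 1 + s 2) • Γ (s 2 / (s 1 + s 2)) := by
  have hc (i : Fin 3) : Continuous fun s : stdSimplex ℝ (Fin 3) => s i :=
    (continuous_apply i).comp continuous_subtype_val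
  rw [continuous_iff_continuousAt]
  intro s
  -- At the apex the quotient is meaningless, but `Γ` is bounded and its factor tends to `0`.
  by_cases hs : s 1 + s 2 = 0
  · rw [ContinuousAt, hs, zero_smul]
    refine NormedField.tendsto_zero_smul_of_tendsto_zero_of_bounded ?_ ?_
    · rw [← hs]
      exact ((hc 1).add (hc 2)).continuousAt
    · exact isBoundedUnder_of ⟨R, fun t => hR _⟩
  · have h2 : ContinuousAt (fun s : stdSimplex ℝ (Fin 3) => s 2 / (s 1 + s 2)) s :=
      (hc 2).continuousAt.div ((hc 1).add (hc 2)).continuousAt hs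
    exact ((hc 1).add (hc 2)).continuousAt.smul (hΓ.continuousAt.comp h2)

/-- The primitive at `y` is the value of `ℓ` on the segment, in a chart, from the centre to `y`. The
triangle identity for the cone over `γ` compares its two end values. -/
lemma exists_local_primitive {n : ℕ} [ChartedSpace (EuclideanSpace ℝ (Fin n)) M]
    (hℓ : (singularChains M).d 2 1 ≫ ℓ = 0) (x : M) :
    ∃ (U : Set M) (f : M → ℝ), IsOpen U ∧ x ∈ U ∧ ∀ γ : C(unitInterval, M),
      (∀ t, γ t ∈ U) → cochainValue ℓ γ = f (γ 1) - f (γ 0) := by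
  let e := chartAt (EuclideanSpace ℝ (Fin n)) x
  obtain ⟨r, hr, hball⟩ := Metric.isOpen_iff.1 e.open_target (e x) (e.map_source
    (mem_chart_source _ x))
  let U := e.source ∩ e ⁻¹' Metric.ball (e x) r
  have hcone : ∀ v ∈ Metric.ball (e x) r, ∀ t ∈ unitInterval,
      e x + t • (v - e x) ∈ Metric.ball (e x) r := fun v hv t ht =>
    (convex_ball (e x) r).add_smul_sub_mem (Metric.mem_ball_self hr) hv ht
  have hseg : ∀ y, ∃ σ : C(unitInterval, M), y ∈ U →
      ∀ t : unitInterval, σ t = e.symm (e x + (t : ℝ) • (e y - e x)) := by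
    intro y
    by_cases hy : y ∈ U
    · refine ⟨⟨fun t => e.symm (e x + (t : ℝ) • (e y - e x)), ?_⟩, fun _ t => rfl⟩
      exact e.continuousOn_symm.comp_continuous (by fun_prop)
        fun t => hball (hcone _ hy.2 t t.2)
    · exact ⟨ContinuousMap.const _ x, fun h => absurd h hy⟩
  choose σ hσ using hseg
  refine ⟨U, fun y => cochainValue ℓ (σ y),
    e.continuousOn.isOpen_inter_preimage e.open_source Metric.isOpen_ball,
    ⟨mem_chart_source _ x, Metric.mem_ball_self hr⟩, fun γ hγ => ?_⟩
  let Γ : ℝ → EuclideanSpace ℝ (Fin n) :=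
    IccExtend (zero_le_one' ℝ) fun t : unitInterval => e (γ t) - e x
  have hΓ : Continuous Γ := by
    refine Continuous.Icc_extend' ?_
    exact (e.continuousOn.comp_continuous γ.continuous fun t => (hγ t).1).sub continuous_const
  have hΓmem : ∀ t, e x + Γ t ∈ Metric.ball (e x) r := by
    intro t
    simp only [Γ, IccExtend, Function.comp_apply, add_sub_cancel]
    exact (hγ _).2
  have hbd : ∀ t, ‖Γ t‖ ≤ r := fun t => by
    have := hΓmem t
    rw [mem_ball_iff_norm, add_sub_cancel_left] at this
    exact this.le
  have hmem : ∀ s : stdSimplex ℝ (Fin 3),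
      e x + (s 1 + s 2) • Γ (s 2 / (s 1 + s 2)) ∈ Metric.ball (e x) r := by
    intro s
    have h1 : s 0 + s 1 + s 2 = 1 := by
      have := stdSimplex.sum_eq_one s
      rwa [Fin.sum_univ_three] at this
    have h0 := s.2.1
    have := hcone _ (hΓmem (s 2 / (s 1 + s 2))) (s 1 + s 2)
      ⟨add_nonneg (h0 1) (h0 2), by have : 0 ≤ s 0 := h0 0; linarith⟩
    rwa [add_sub_cancel_left] at this
  let τ : C(stdSimplex ℝ (Fin 3), M) :=
    ⟨fun s => e.symm (e x + (s 1 + s 2) • Γ (s 2 / (s 1 + s 2))),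
      e.continuousOn_symm.comp_continuous (continuous_const.add (continuous_cone hΓ hbd))
        fun s => hball (hmem s)⟩
  have h := cochainValue_triangle hℓ τ
  have hτ : ∀ (i j : Fin 3) (t : unitInterval), ∃ s : stdSimplex ℝ (Fin 3),
      edgePath τ i j t = e.symm (e x + (s 1 + s 2) • Γ (s 2 / (s 1 + s 2))) ∧
      ∀ k, s k = (1 - (t : ℝ)) * (if k = i then 1 else 0) + t * (if k = j then 1 else 0) :=
    fun i j t => ⟨_, rfl, fun k => rfl⟩
  have h01 : edgePath τ 0 1 = σ (γ 0) := by
    ext t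
    obtain ⟨s, hs, hs'⟩ := hτ 0 1 t
    rw [hs, hσ _ (hγ 0), hs', hs']
    simp [Γ]
  have h02 : edgePath τ 0 2 = σ (γ 1) := by
    ext t
    obtain ⟨s, hs, hs'⟩ := hτ 0 2 t
    rw [hs, hσ _ (hγ 1), hs', hs']
    by_cases ht : (t : ℝ) = 0
    · simp [ht]
    · simp [Γ, div_self ht]
  have h12 : edgePath τ 1 2 = γ := by
    ext t
    obtain ⟨s, hs, hs'⟩ := hτ 1 2 t
    rw [hs, hs', hs']
    simp [Γ, IccExtend_val, e.left_inv (hγ t).1]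
  rw [h01, h02, h12] at h
  linarith

end Cochain

end MatherBeta

/-! ### From closed cochains to smooth closed 1-forms. -/

namespace MatherBeta
variable {n : ℕ} {M : Type u} [TopologicalSpace M]
  [ChartedSpace (EuclideanSpace ℝ (Fin n)) M] [IsManifold (𝓡 n) ∞ M]

lemma fderiv_comp_extChartAt_symm {f : M → ℝ} {x₀ : M} {y : EuclideanSpace ℝ (Fin n)}
    (hy : y ∈ (extChartAt (𝓡 n) x₀).target)
    (hf : MDifferentiableAt (𝓡 n) 𝓘(ℝ, ℝ) f ((extChartAt (𝓡 n) x₀).symm y)) :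
    fderiv ℝ (f ∘ (extChartAt (𝓡 n) x₀).symm) y =
      (mfderiv (𝓡 n) 𝓘(ℝ, ℝ) f ((extChartAt (𝓡 n) x₀).symm y)).comp
        (mfderiv 𝓘(ℝ, EuclideanSpace ℝ (Fin n)) (𝓡 n) (extChartAt (𝓡 n) x₀).symm y) := by
  have hs : MDifferentiableAt 𝓘(ℝ, EuclideanSpace ℝ (Fin n)) (𝓡 n)
      (extChartAt (𝓡 n) x₀).symm y :=
    ((contMDiffOn_extChartAt_symm (n := ∞) x₀).contMDiffAt
      ((isOpen_extChartAt_target x₀).mem_nhds hy)).mdifferentiableAt (by simp)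
  rw [← mfderiv_eq_fderiv]
  exact mfderiv_comp y hf hs

lemma isOpen_chart_preimage {n : ℕ} {M : Type u} [TopologicalSpace M]
    [ChartedSpace (EuclideanSpace ℝ (Fin n)) M] {U : Set M} (hU : IsOpen U) (x₀ : M) :
    IsOpen ((extChartAt (𝓡 n) x₀).target ∩ (extChartAt (𝓡 n) x₀).symm ⁻¹' U) :=
  (continuousOn_extChartAt_symm x₀).isOpen_inter_preimage (isOpen_extChartAt_target x₀) hU

lemma contDiffOn_comp_extChartAt_symm {f : M → ℝ} {U : Set M}
    (hf : ContMDiffOn (𝓡 n) 𝓘(ℝ, ℝ) ∞ f U) (x₀ : M) :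
    ContDiffOn ℝ ∞ (f ∘ (extChartAt (𝓡 n) x₀).symm)
      ((extChartAt (𝓡 n) x₀).target ∩ (extChartAt (𝓡 n) x₀).symm ⁻¹' U) :=
  (hf.comp ((contMDiffOn_extChartAt_symm x₀).mono inter_subset_left)
    inter_subset_right).contDiffOn

/-- Two smooth functions with the same differential differ by a locally constant function. -/
lemma eventually_sub_eq_of_differential_eq {f f' : M → ℝ} {U : Set M} (hU : IsOpen U) {x : M}
    (hx : x ∈ U) (hf : ContMDiffOn (𝓡 n) 𝓘(ℝ, ℝ) ∞ f U) (hf' : ContMDiffOn (𝓡 n) 𝓘(ℝ, ℝ) ∞ f' U)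
    (h : ∀ y ∈ U, ∀ v : TangentSpace (𝓡 n) y, differential f ⟨y, v⟩ = differential f' ⟨y, v⟩) :
    ∀ᶠ y in 𝓝 x, f y - f' y = f x - f' x := by
  set e := extChartAt (𝓡 n) x with he
  have hW := isOpen_chart_preimage (n := n) hU x
  have hxW : e x ∈ e.target ∩ e.symm ⁻¹' U :=
    ⟨mem_extChartAt_target x, by simpa [he, extChartAt_to_inv] using hx⟩
  obtain ⟨r, hr, hball⟩ := Metric.isOpen_iff.1 hW _ hxW
  have hd := ((contDiffOn_comp_extChartAt_symm hf x).mono hball).differentiableOn (by simp)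
  have hd' := ((contDiffOn_comp_extChartAt_symm hf' x).mono hball).differentiableOn (by simp)
  obtain ⟨a, ha⟩ := Metric.isOpen_ball.exists_eq_add_of_fderiv_eq
    (convex_ball (e x) r).isPreconnected hd hd' (fun y hy => by
      have hyW := hball hy
      have hm := (hf.contMDiffAt (hU.mem_nhds hyW.2)).mdifferentiableAt (by simp)
      have hm' := (hf'.contMDiffAt (hU.mem_nhds hyW.2)).mdifferentiableAt (by simp)
      rw [fderiv_comp_extChartAt_symm hyW.1 hm, fderiv_comp_extChartAt_symm hyW.1 hm']
      congr 1
      ext v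
      exact h _ hyW.2 v)
  have hax : f x - f' x = a := by
    have := ha (Metric.mem_ball_self hr)
    simp only [Function.comp_apply, he, extChartAt_to_inv] at this
    linarith
  filter_upwards [(continuousAt_extChartAt (I := 𝓡 n) x).preimage_mem_nhds
    (Metric.ball_mem_nhds _ hr), extChartAt_source_mem_nhds (I := 𝓡 n) x] with y hy hys
  have := ha hy
  simp only [Function.comp_apply, (extChartAt (𝓡 n) x).left_inv hys] at this
  rw [hax]
  linarith

lemma IsPrimitiveAlong.eventually_sub_eq {η : ClosedOneForm n M} {γ : C(unitInterval, M)}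
    {F F' : unitInterval → ℝ} (hF : IsPrimitiveAlong η γ F) (hF' : IsPrimitiveAlong η γ F')
    (t : unitInterval) : ∀ᶠ s in 𝓝 t, F s - F' s = F t - F' t := by
  obtain ⟨U, f, hU, hxU, hf, hdf, hev⟩ := hF t
  obtain ⟨U', f', hU', hxU', hf', hdf', hev'⟩ := hF' t
  have h := eventually_sub_eq_of_differential_eq (hU.inter hU') ⟨hxU, hxU'⟩
    (hf.mono inter_subset_left) (hf'.mono inter_subset_right)
    (fun y hy v => (hdf y hy.1 v).trans (hdf' y hy.2 v).symm)
  filter_upwards [hev, hev', γ.continuous.continuousAt.eventually h] with s h1 h2 h3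
  linarith

/-- Two primitives along `γ` differ by a locally constant function on a connected interval, so the
chosen one is immaterial. -/
lemma pathIntegral_eq {η : ClosedOneForm n M} {γ : C(unitInterval, M)}
    {F : unitInterval → ℝ} (hF : IsPrimitiveAlong η γ F) : pathIntegral η γ = F 1 - F 0 := by
  have hex : ∃ F : unitInterval → ℝ, IsPrimitiveAlong η γ F := ⟨F, hF⟩
  rw [pathIntegral, dif_pos hex]
  have hloc : IsLocallyConstant fun s => hex.choose s - F s :=
    (IsLocallyConstant.iff_eventually_eq _).2 fun t => hex.choose_spec.eventually_sub_eq hF t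
  have := hloc.apply_eq_of_preconnectedSpace 0 1
  linarith

/-- A form that is locally the differential of a smooth function is a closed 1-form. -/
lemma exists_closedOneForm (ξ : ∀ x : M, TangentSpace (𝓡 n) x →L[ℝ] ℝ)
    (hξ : ∀ x, ∃ (U : Set M) (F : M → ℝ), IsOpen U ∧ x ∈ U ∧
      ContMDiffOn (𝓡 n) 𝓘(ℝ, ℝ) ∞ F U ∧ ∀ y ∈ U, ξ y = mfderiv (𝓡 n) 𝓘(ℝ, ℝ) F y) :
    ∃ η : ClosedOneForm n M, η.toFun = ξ := by
  refine ⟨⟨ξ, fun x => ?_, fun x₀ y hy u v => ?_⟩, rfl⟩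
  · obtain ⟨U, F, hU, hxU, hF, hξF⟩ := hξ x
    rw [contMDiffAt_hom_bundle]
    refine ⟨contMDiffAt_id, ?_⟩
    have h := (hF.contMDiffAt (hU.mem_nhds hxU)).mfderiv_const (m := ∞) (by simp)
    refine h.congr_of_eventuallyEq ?_
    filter_upwards [hU.mem_nhds hxU] with y hy
    ext v
    simp only [hξF y hy, inTangentCoordinates, ContinuousLinearMap.inCoordinates]
    simp
    rfl
  · obtain ⟨U, F, hU, hxU, hF, hξF⟩ := hξ ((extChartAt (𝓡 n) x₀).symm y)
    have hW := (isOpen_chart_preimage (n := n) hU x₀).mem_nhds ⟨hy, hxU⟩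
    -- In the chart the form is the derivative of a smooth function, so closedness is the symmetry
    -- of second derivatives.
    have heq : coordForm ξ x₀ =ᶠ[𝓝 y] fderiv ℝ (F ∘ (extChartAt (𝓡 n) x₀).symm) := by
      filter_upwards [hW] with w hw
      rw [fderiv_comp_extChartAt_symm hw.1
        ((hF.contMDiffAt (hU.mem_nhds hw.2)).mdifferentiableAt (by simp)), ← hξF _ hw.2]
      rfl
    rw [heq.fderiv_eq]
    have hsymm := (((contDiffOn_comp_extChartAt_symm hF x₀).contDiffAt hW).of_le
      (m := 2) (WithTop.coe_le_coe.2 (le_top : (2 : ℕ∞) ≤ ⊤))).isSymmSndFDerivAt (by simp)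
    exact hsymm.eq u v

lemma subpath_apply_zero {M : Type u} [TopologicalSpace M] (γ : C(unitInterval, M))
    (a b : unitInterval) : subpath γ a b 0 = γ a :=
  congrArg γ (Subtype.ext (by simp))

lemma subpath_apply_one {M : Type u} [TopologicalSpace M] (γ : C(unitInterval, M))
    (a b : unitInterval) : subpath γ a b 1 = γ b :=
  congrArg γ (Subtype.ext (by simp))

/-- Along a path inside `U ∩ U'` both increments equal the value of `ℓ`; nearby points are joined by
such paths. -/
lemma eventually_sub_eq_of_cochain {M : Type u} [TopologicalSpace M]
    [LocallyPathConnectedSpace M] {ℓ : (singularChains M).X 1 ⟶ coeff.{u}} {U U' : Set M}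
    {f f' : M → ℝ} (hU : IsOpen U) (hU' : IsOpen U')
    (hf : ∀ γ : C(unitInterval, M), (∀ t, γ t ∈ U) → cochainValue ℓ γ = f (γ 1) - f (γ 0))
    (hf' : ∀ γ : C(unitInterval, M), (∀ t, γ t ∈ U') → cochainValue ℓ γ = f' (γ 1) - f' (γ 0))
    {y : M} (hy : y ∈ U) (hy' : y ∈ U') :
    ∀ᶠ z in 𝓝 y, f z - f' z = f y - f' y := by
  obtain ⟨V, ⟨hV, hVp⟩, hVU⟩ := (path_connected_basis y).mem_iff.1
    ((hU.inter hU').mem_nhds ⟨hy, hy'⟩)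
  filter_upwards [hV] with z hz
  obtain ⟨γ, hγ⟩ := hVp.joinedIn y (mem_of_mem_nhds hV) z hz
  have h1 := hf γ.toContinuousMap fun t => (hVU (hγ t)).1
  have h2 := hf' γ.toContinuousMap fun t => (hVU (hγ t)).2
  have h3 : γ.toContinuousMap 1 = z := γ.target
  have h4 : γ.toContinuousMap 0 = y := γ.source
  rw [h3, h4] at h1 h2
  linarith

/-- Every closed real singular 1-cochain is, up to a coboundary, the integration of a smooth closed
1-form. -/
lemma exists_closedOneForm_pathIntegral_eq [T2Space M] [CompactSpace M]
    {ℓ : (singularChains M).X 1 ⟶ coeff.{u}} (hℓ : (singularChains M).d 2 1 ≫ ℓ = 0) :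
    ∃ (η : ClosedOneForm n M) (G : M → ℝ), ∀ γ : C(unitInterval, M),
      pathIntegral η γ = cochainValue ℓ γ - (G (γ 1) - G (γ 0)) := by
  have := ChartedSpace.locallyPathConnectedSpace (EuclideanSpace ℝ (Fin n)) M
  choose U f hU hxU hf using exists_local_primitive (n := n) hℓ
  obtain ⟨ρ, hρ⟩ := SmoothPartitionOfUnity.exists_isSubordinate (𝓡 n) (s := univ) isClosed_univ
    U hU (fun x _ => mem_iUnion.2 ⟨x, hxU x⟩)
  -- The local primitives `f x` need not even be continuous. Yet `f x - G` is a weighted sum of the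
  -- locally constant `f x - f k`, hence smooth, and its differential does not depend on `x`.
  let G : M → ℝ := fun y => ∑ᶠ k, ρ k y • f k y
  have hG : ∀ x y, f x y - G y = ∑ᶠ k, ρ k y • (f x y - f k y) := by
    intro x y
    have hfin : (Function.support fun k => ρ k y).Finite := ρ.locallyFinite.point_finite y
    simp_rw [smul_sub]
    rw [finsum_sub_distrib (f := fun k => ρ k y • f x y) (g := fun k => ρ k y • f k y)
      (hfin.subset fun k hk h0 => hk (by simp only [h0, zero_smul]))
      (hfin.subset fun k hk h0 => hk (by simp only [h0, zero_smul])), ← finsum_smul,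
      ρ.sum_eq_one (mem_univ y), one_smul]
  have hsmooth : ∀ x, ContMDiffOn (𝓡 n) 𝓘(ℝ, ℝ) ∞ (fun y => f x y - G y) (U x) := by
    intro x y hy
    refine ContMDiffAt.contMDiffWithinAt ?_
    simp_rw [hG]
    refine ρ.contMDiffAt_finsum fun k hk => ?_
    refine contMDiffAt_const.congr_of_eventuallyEq
      (eventually_sub_eq_of_cochain (hU x) (hU k) (hf x) (hf k) hy (hρ k hk))
  have hmf : ∀ x, ∀ y ∈ U x, mfderiv (𝓡 n) 𝓘(ℝ, ℝ) (fun z => f y z - G z) y =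
      mfderiv (𝓡 n) 𝓘(ℝ, ℝ) (fun z => f x z - G z) y := by
    intro x y hy
    have hd := (((hsmooth x).contMDiffAt ((hU x).mem_nhds hy)).mdifferentiableAt
      (by simp)).hasMFDerivAt
    have hc := hd.add (hasMFDerivAt_const (I := 𝓡 n) (I' := 𝓘(ℝ, ℝ)) (f y y - f x y) y)
    refine (hc.congr_of_eventuallyEq ?_).mfderiv.trans (add_zero _)
    filter_upwards [eventually_sub_eq_of_cochain (hU y) (hU x) (hf y) (hf x) (hxU y) hy] with z hz
    simp only [Pi.add_apply]
    linarith
  obtain ⟨η, hη⟩ := exists_closedOneForm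
    (fun x => mfderiv (𝓡 n) 𝓘(ℝ, ℝ) (fun y => f x y - G y) x) fun x =>
      ⟨U x, fun y => f x y - G y, hU x, hxU x, hsmooth x, hmf x⟩
  refine ⟨η, G, fun γ => ?_⟩
  have hprim : IsPrimitiveAlong η γ fun t => cochainValue ℓ (subpath γ 0 t) - G (γ t) := by
    intro t
    refine ⟨U (γ t), fun y => f (γ t) y - G y, hU _, hxU _, hsmooth _, fun y hy v => ?_, ?_⟩
    · rw [hη]
      exact (congrArg (fun A : TangentSpace (𝓡 n) y →L[ℝ] ℝ => A v) (hmf _ y hy)).symm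
    · have hnear : ∀ᶠ s in 𝓝 t, uIcc t s ⊆ γ ⁻¹' U (γ t) :=
        tendsto_smallSets_iff.1 ((tendsto_const_nhds (x := t)).uIcc tendsto_id) _
          (γ.continuous.continuousAt.preimage_mem_nhds ((hU _).mem_nhds (hxU _)))
      filter_upwards [hnear] with s hs
      have h1 := hf (γ t) (subpath γ t s) (subpath_mem hs)
      rw [subpath_apply_one, subpath_apply_zero] at h1
      have h2 := cochainValue_subpath_add hℓ γ 0 t s
      linarith
  -- Additivity at equal parameters makes `ℓ` vanish on the constant path, fixing the primitive at
  -- `0`.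
  have h0 := cochainValue_subpath_add hℓ γ 0 0 0
  rw [pathIntegral_eq hprim, subpath_zero_one]
  linarith

/-- A nonzero real homology class of degree one pairs nontrivially with a closed 1-form. -/
lemma exists_chainIntegral_ne_zero [T2Space M] [CompactSpace M] {h : H1 M} (hh : h ≠ 0) :
    ∃ z : (singularChains M).cycles 1, (singularChains M).homologyπ 1 z = h ∧
      ∃ η : ClosedOneForm n M,
        (chainIntegral η ((singularChains M).iCycles 1 z) : ULift.{u} ℝ).down ≠ 0 := by
  obtain ⟨z, hz, ℓ, hℓ, hne⟩ := exists_functional_of_ne_zero hh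
  obtain ⟨η, G, hG⟩ := exists_closedOneForm_pathIntegral_eq (n := n) hℓ
  exact ⟨z, hz, η, by rwa [chainIntegral_iCycles_eq hG z]⟩

end MatherBeta

/-! ### The comparison theorem. -/

theorem mainTheorem1 {n : ℕ} {M : Type u} [TopologicalSpace M] [T2Space M] [CompactSpace M]
    [ChartedSpace (EuclideanSpace ℝ (Fin n)) M] [IsManifold (𝓡 n) ∞ M]
    (g₁ g₂ : MatherBeta.Metric n M) :
    (∀ h : MatherBeta.H1 M,
      MatherBeta.beta g₂ h ≤ MatherBeta.distortion g₁ g₂ * MatherBeta.beta g₁ h) ∧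
    (∀ h : MatherBeta.H1 M, h ≠ 0 →
      (MatherBeta.beta g₂ h = MatherBeta.distortion g₁ g₂ * MatherBeta.beta g₁ h ↔
        MatherBeta.matherMeasures g₁ h ⊆ MatherBeta.matherMeasures g₂ h ∧
        (∀ p ∈ MatherBeta.matherSet g₁ h,
          g₂.inner p.1 p.2 p.2 = MatherBeta.distortion g₁ g₂ * g₁.inner p.1 p.2 p.2) ∧
        MatherBeta.matherSet g₁ h ⊆ MatherBeta.matherSet g₂ h)) ∧
    (∀ (φ : M → ℝ) (m : ℝ), ContMDiff (𝓡 n) 𝓘(ℝ, ℝ) ∞ φ → (∀ x, 0 < φ x) →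
      (∀ (x : M) (v w : TangentSpace (𝓡 n) x), g₂.inner x v w = φ x * g₁.inner x v w) →
      IsGreatest (Set.range φ) m →
      (∀ h : MatherBeta.H1 M, MatherBeta.beta g₂ h ≤ m * MatherBeta.beta g₁ h) ∧
      (∀ h : MatherBeta.H1 M, h ≠ 0 →
        (MatherBeta.beta g₂ h = m * MatherBeta.beta g₁ h ↔
          MatherBeta.matherMeasures g₁ h ⊆ MatherBeta.matherMeasures g₂ h ∧
          (∀ x ∈ MatherBeta.projectedMatherSet g₁ h, φ x = m) ∧
          MatherBeta.projectedMatherSet g₁ h ⊆ MatherBeta.projectedMatherSet g₂ h))) := by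
  refine ⟨fun h => ?_, fun h hh => ⟨fun heq => ?_, fun ⟨hsub, heq, _⟩ => ?_⟩,
    fun φ m hφ hpos hconf hm => ?_⟩
  · exact MatherBeta.beta_le_mul g₁ g₂ (MatherBeta.distortion_nonneg g₁ g₂)
      (MatherBeta.inner_le_distortion_mul g₁ g₂) h
  · have key := fun μ (hμ : μ ∈ MatherBeta.matherMeasures g₁ h) =>
      MatherBeta.mem_matherMeasures_of_beta_eq g₁ g₂ (MatherBeta.distortion_nonneg g₁ g₂)
        (MatherBeta.inner_le_distortion_mul g₁ g₂) heq hμ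
    have hsub : MatherBeta.matherMeasures g₁ h ⊆ MatherBeta.matherMeasures g₂ h :=
      fun μ hμ => (key μ hμ).1
    refine ⟨hsub, fun p hp => ?_, biUnion_subset_biUnion_left hsub⟩
    obtain ⟨μ, hμ, hpμ⟩ := mem_iUnion₂.1 hp
    exact (key μ hμ).2 p hpμ
  · exact MatherBeta.beta_eq_of_eqOn_matherSet g₁ g₂ (MatherBeta.distortion_nonneg g₁ g₂) hsub heq
  · obtain ⟨⟨x₀, rfl⟩, hmax⟩ := hm
    have hle : ∀ (x : M) (v : TangentSpace (𝓡 n) x),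
        g₂.inner x v v ≤ φ x₀ * g₁.inner x v v := fun x v => by
      rw [hconf]
      exact mul_le_mul_of_nonneg_right (hmax ⟨x, rfl⟩) (g₁.inner_nonneg x v)
    refine ⟨MatherBeta.beta_le_mul g₁ g₂ (hpos x₀).le hle,
      fun h hh => ⟨fun heq => ?_, fun ⟨hsub, heq, _⟩ => ?_⟩⟩
    · have key := fun μ (hμ : μ ∈ MatherBeta.matherMeasures g₁ h) =>
        MatherBeta.mem_matherMeasures_of_beta_eq g₁ g₂ (hpos x₀).le hle heq hμ
      have hsub : MatherBeta.matherMeasures g₁ h ⊆ MatherBeta.matherMeasures g₂ h :=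
        fun μ hμ => (key μ hμ).1
      refine ⟨hsub, ?_, image_mono (biUnion_subset_biUnion_left hsub)⟩
      rintro _ ⟨p, hp, rfl⟩
      obtain ⟨μ, hμ, hpμ⟩ := mem_iUnion₂.1 hp
      -- `h ≠ 0` excludes minimisers on the zero section, where the equality of actions says nothing
      -- about `φ`.
      obtain ⟨z, hz, η, hη⟩ := MatherBeta.exists_chainIntegral_ne_zero (n := n) hh
      exact MatherBeta.conformalFactor_eq_of_mem_support g₁ g₂ hφ.continuous hconf
        (MatherBeta.measure_zeroSection_eq_zero g₁ hz hη hμ) (key μ hμ).2 p hpμ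
    · refine MatherBeta.beta_eq_of_eqOn_matherSet g₁ g₂ (hpos x₀).le hsub fun p hp => ?_
      rw [hconf, heq p.1 ⟨p, hp, rfl⟩]
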